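/- **Setting.** All algebras are associative algebras over $\mathbb C$, not necessarily unital. $M(A)$ is the multiplier algebra of $A$ (pairs $(\lambda,\rho)$ of module maps of $A$ with $\rho(a)b=a\lambda(b)$), $1$ is its unit and $\iota$ is an identity map. Products of subspaces are linear spans. Let $A$ be an algebra with non-degenerate product and $A^2=A$, and let $\Delta:A\to M(A\otimes A)$ be a regular and full coproduct, that is: * $\Delta$ is a homomorphism, and $\Delta(a)(1\otimes b)$, $(c\otimes 1)\Delta(a)$, $(1\otimes b)\Delta(a)$, $\Delta(a)(c\otimes 1)$ lie in $A\otimes A$ for all $a,b,c\in A$; * $(c\otimes1\otimes1)(\Delta\otimes\iota)(\Delta(a)(1\otimes b))=(\iota\otimes\Delta)((c\otimes1)\Delta(a))(1\otimes1\otimes b)$ for all $a,b,c\in A$; * if $V,W\subseteq A$ are subspaces with $\Delta(A)(1\otimes A)\subseteq V\otimes A$ and $(A\otimes1)\Delta(A)\subseteq A\otimes W$, then $V=W=A$. Assume that there is an idempotent $E\in M(A\otimes A)$ with $\Delta(A)(A\otimes A)=E(A\otimes A)$ and $(A\otimes A)\Delta(A)=(A\otimes A)E$, and that $$(\Delta\otimes\iota)E=(E\otimes1)(1\otimes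 E)=(1\otimes E)(E\otimes 1),$$ where $\Delta\otimes\iota$ is extended to $M(A\otimes A)$ by requiring $(\Delta\otimes\iota)(m)=(E\otimes1)(\Delta\otimes\iota)(m)=(\Delta\otimes\iota)(m)(E\otimes1)$. Assume that there are subalgebras $B,C$ of $M(A)$ with $BA=AB=A$ and $CA=AC=A$ such that $E\in M(B\otimes C)\subseteq M(A\otimes A)$ is a regular separability idempotent: $E(1\otimes y)$, $(x\otimes1)E$, $(1\otimes y)E$, $E(x\otimes1)$ lie in $B\otimes C$ for all $x\in B$, $y\in C$; the left leg of $E$ is all of $B$ and its right leg is all of $C$ (the only subspace $V\subseteq B$ with $E(1\otimes C)\subseteq V\otimes C$ is $B$, and the only subspace $W\subseteq C$ with $E(B\otimes 1)\subseteq B\otimes W$ is $C$); and $E(B\otimes1)=E(1\otimes C)$, $(B\otimes1)E=(1\otimes C)E$. Put $A_s=M(B)$ and $A_t=M(C)$, regarded as subalgebras of $M(A)$. A *left integral* is a non-zero linear functional $\varphi$ on $A$ with $(\iota\otimes\varphi)\Delta(a)\in A_t$ for all $a\in A$. A *right integral* is a non-zero linear functional $\psi$ on $A$ with $(\psi\otimes\iota)\Delta(a)\in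 A_s$ for all $a\in A$. Assume that the set of left integrals and the set of right integrals are both faithful, where a set $\mathcal F$ of functionals is faithful if $a=0$ whenever $\varphi(ab)=0$ for all $b\in A$, $\varphi\in\mathcal F$, and also $a=0$ whenever $\varphi(ba)=0$ for all $b\in A$, $\varphi\in\mathcal F$. (Then $(A,\Delta)$ is a regular weak multiplier Hopf algebra.) Let $S:A\to M(A)$ be the antipode of $(A,\Delta)$. It is given by the formula $$R_1(a\otimes b)=\sum_{(a)}a_{(1)}\otimes S(a_{(2)})b\qquad(a,b\in A),$$ that is, $(c\otimes 1)R_1(a\otimes b)=\sum_i p_i\otimes S(q_i)b$ whenever $c\in A$ and $(c\otimes 1)\Delta(a)=\sum_i p_i\otimes q_i$. Here $R_1:A\otimes A\to A\otimes A$ is the generalized inverse of the canonical map $T_1(a\otimes b)=\Delta(a)(1\otimes b)$ for which $T_1R_1$ is left multiplication by $E$, $R_1T_1R_1=R_1$, and $R_1T_1=G_1$, where $G_1:A\otimes A\to A\otimes A$ is the linear map determined by $$(G_1\otimes\iota)(\Delta_{13}(a)(1\otimes b\otimes c))=\Delta_{13}(a)(1\otimes E)(1\otimes b\otimes c)\qquad(a,b,c\in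 A).$$ **Proposition 2.15.** Let $\varphi$ be a left integral, let $a,b\in A$ and define $p=(\iota\otimes\varphi)(\Delta(a)(1\otimes b))$. Then $$S(p)=(\iota\otimes\varphi)((1\otimes a)\Delta(b)).$$ -/

import Mathlib

open scoped TensorProduct

namespace WMHA

section Multipliers

/-- The pairs `(l, r)` of linear maps of `A`, with `l` a right module map, `r` a left module map and
`r(a) b = a l(b)`. The product is `(l, r)(l', r') = (l ∘ l', r' ∘ r)` and the unit is `(id, id)`. -/
def multiplierSubalgebra (A : Type*) [NonUnitalRing A] [Module ℂ A] [IsScalarTower ℂ A A]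
    [SMulCommClass ℂ A A] :
    Subalgebra ℂ (Module.End ℂ A × (Module.End ℂ A)ᵐᵒᵖ) where
  carrier := {m | (∀ a b : A, m.1 (a * b) = m.1 a * b) ∧
    (∀ a b : A, m.2.unop (a * b) = a * m.2.unop b) ∧
    (∀ a b : A, m.2.unop a * b = a * m.1 b)}
  mul_mem' := by
    rintro m n ⟨h1, h2, h3⟩ ⟨k1, k2, k3⟩
    refine ⟨fun a b => ?_, fun a b => ?_, fun a b => ?_⟩ <;> simp [h1, h2, h3, k1, k2, k3]
  add_mem' := by
    rintro m n ⟨h1, h2, h3⟩ ⟨k1, k2, k3⟩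
    refine ⟨fun a b => ?_, fun a b => ?_, fun a b => ?_⟩ <;>
      simp [h1, h2, h3, k1, k2, k3, mul_add, add_mul]
  algebraMap_mem' := by
    intro r
    refine ⟨fun a b => ?_, fun a b => ?_, fun a b => ?_⟩ <;>
      simp [Algebra.algebraMap_eq_smul_one, smul_mul_assoc, mul_smul_comm]

/-- The multiplier algebra `M(A)` of a complex (not necessarily unital) algebra `A`. -/
def MultiplierAlgebra (A : Type*) [NonUnitalRing A] [Module ℂ A] [IsScalarTower ℂ A A]
    [SMulCommClass ℂ A A] : Type _ :=
  multiplierSubalgebra A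

instance instRingMultiplierAlgebra (A : Type*) [NonUnitalRing A] [Module ℂ A]
    [IsScalarTower ℂ A A] [SMulCommClass ℂ A A] : Ring (MultiplierAlgebra A) :=
  inferInstanceAs (Ring (multiplierSubalgebra A))

instance instAlgebraMultiplierAlgebra (A : Type*) [NonUnitalRing A] [Module ℂ A]
    [IsScalarTower ℂ A A] [SMulCommClass ℂ A A] : Algebra ℂ (MultiplierAlgebra A) :=
  inferInstanceAs (Algebra ℂ (multiplierSubalgebra A))

variable {A : Type*} [NonUnitalRing A] [Module ℂ A] [IsScalarTower ℂ A A] [SMulCommClass ℂ A A]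
variable {B : Type*} [NonUnitalRing B] [Module ℂ B] [IsScalarTower ℂ B B] [SMulCommClass ℂ B B]

/-- Left multiplication `a ↦ m a` by a multiplier. -/
def lact (m : MultiplierAlgebra A) : A →ₗ[ℂ] A := m.1.1

/-- Right multiplication `a ↦ a m` by a multiplier. -/
def ract (m : MultiplierAlgebra A) : A →ₗ[ℂ] A := m.1.2.unop

theorem lact_mul_right (m : MultiplierAlgebra A) (a b : A) : lact m (a * b) = lact m a * b :=
  m.2.1 a b

theorem ract_mul_left (m : MultiplierAlgebra A) (a b : A) : ract m (a * b) = a * ract m b :=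
  m.2.2.1 a b

theorem ract_mul_eq (m : MultiplierAlgebra A) (a b : A) : ract m a * b = a * lact m b :=
  m.2.2.2 a b

/-- The multiplier with given left and right actions. -/
def mkMultiplier (l r : A →ₗ[ℂ] A) (h1 : ∀ a b, l (a * b) = l a * b)
    (h2 : ∀ a b, r (a * b) = a * r b) (h3 : ∀ a b, r a * b = a * l b) : MultiplierAlgebra A :=
  ⟨(l, MulOpposite.op r), h1, h2, h3⟩

theorem ext_multiplier {m n : MultiplierAlgebra A} (h1 : ∀ a, lact m a = lact n a)
    (h2 : ∀ a, ract m a = ract n a) : m = n := by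
  apply Subtype.ext
  apply Prod.ext
  · exact LinearMap.ext h1
  · exact MulOpposite.unop_injective (LinearMap.ext h2)

/-- The canonical map `A → M(A)`, which is injective when the product of `A` is non-degenerate. -/
def of (A : Type*) [NonUnitalRing A] [Module ℂ A] [IsScalarTower ℂ A A] [SMulCommClass ℂ A A] :
    A →ₙₐ[ℂ] MultiplierAlgebra A where
  toFun a := mkMultiplier (LinearMap.mulLeft ℂ a) (LinearMap.mulRight ℂ a)
    (fun _ _ => by simp [mul_assoc]) (fun _ _ => by simp [mul_assoc])
    (fun _ _ => by simp [mul_assoc])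
  map_smul' c a := ext_multiplier
    (fun b => by change (c • a) * b = c • (a * b); exact smul_mul_assoc c a b)
    (fun b => by change b * (c • a) = c • (b * a); exact mul_smul_comm c b a)
  map_zero' := ext_multiplier (fun b => zero_mul b) (fun b => mul_zero b)
  map_add' a a' := ext_multiplier (fun b => add_mul a a' b) (fun b => mul_add b a a')
  map_mul' a a' := ext_multiplier (fun b => mul_assoc a a' b) (fun b => (mul_assoc b a a').symm)

/-- The multiplier `m ⊗ n` of `A ⊗ B`. -/
def tmulMultiplier (m : MultiplierAlgebra A) (n : MultiplierAlgebra B) :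
    MultiplierAlgebra (A ⊗[ℂ] B) :=
  mkMultiplier (TensorProduct.map (lact m) (lact n)) (TensorProduct.map (ract m) (ract n))
    (by
      intro x y
      induction x with
      | zero => simp
      | add x x' hx hx' => simp only [add_mul, map_add, hx, hx']
      | tmul a b =>
        induction y with
        | zero => simp
        | add y y' hy hy' => simp only [mul_add, map_add, hy, hy']
        | tmul a' b' => simp [lact_mul_right])
    (by
      intro x y
      induction x with
      | zero => simp
      | add x x' hx hx' => simp only [add_mul, map_add, hx, hx']
      | tmul a b =>
        induction y with
        | zero => simp
        | add y y' hy hy' => simp only [mul_add, map_add, hy, hy']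
        | tmul a' b' => simp [ract_mul_left])
    (by
      intro x y
      induction x with
      | zero => simp
      | add x x' hx hx' => simp only [add_mul, map_add, hx, hx']
      | tmul a b =>
        induction y with
        | zero => simp
        | add y y' hy hy' => simp only [mul_add, map_add, hy, hy']
        | tmul a' b' => simp [ract_mul_eq])

/-- The bilinear map `(m, n) ↦ m ⊗ n` from `M(A) × M(B)` to `M(A ⊗ B)`. -/
def tmulBilin (A B : Type*) [NonUnitalRing A] [Module ℂ A] [IsScalarTower ℂ A A]
    [SMulCommClass ℂ A A] [NonUnitalRing B] [Module ℂ B] [IsScalarTower ℂ B B]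
    [SMulCommClass ℂ B B] :
    MultiplierAlgebra A →ₗ[ℂ] MultiplierAlgebra B →ₗ[ℂ] MultiplierAlgebra (A ⊗[ℂ] B) :=
  LinearMap.mk₂ ℂ tmulMultiplier
    (fun m m' n => ext_multiplier
      (fun x => LinearMap.congr_fun (TensorProduct.map_add_left (lact m) (lact m') (lact n)) x)
      (fun x => LinearMap.congr_fun (TensorProduct.map_add_left (ract m) (ract m') (ract n)) x))
    (fun c m n => ext_multiplier
      (fun x => LinearMap.congr_fun (TensorProduct.map_smul_left c (lact m) (lact n)) x)
      (fun x => LinearMap.congr_fun (TensorProduct.map_smul_left c (ract m) (ract n)) x))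
    (fun m n n' => ext_multiplier
      (fun x => LinearMap.congr_fun (TensorProduct.map_add_right (lact m) (lact n) (lact n')) x)
      (fun x => LinearMap.congr_fun (TensorProduct.map_add_right (ract m) (ract n) (ract n')) x))
    (fun c m n => ext_multiplier
      (fun x => LinearMap.congr_fun (TensorProduct.map_smul_right c (lact m) (lact n)) x)
      (fun x => LinearMap.congr_fun (TensorProduct.map_smul_right c (ract m) (ract n)) x))

theorem assoc_mul (x y : (A ⊗[ℂ] A) ⊗[ℂ] A) :
    TensorProduct.assoc ℂ A A A (x * y) =
      TensorProduct.assoc ℂ A A A x * TensorProduct.assoc ℂ A A A y := by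
  induction x with
  | zero => simp
  | add x x' hx hx' => simp only [add_mul, map_add, hx, hx']
  | tmul u c =>
    induction y with
    | zero => simp
    | add y y' hy hy' => simp only [mul_add, map_add, hy, hy']
    | tmul v d =>
      induction u with
      | zero => simp
      | add u u' hu hu' => simp only [TensorProduct.add_tmul, add_mul, map_add, hu, hu']
      | tmul a b =>
        induction v with
        | zero => simp
        | add v v' hv hv' => simp only [TensorProduct.add_tmul, mul_add, map_add, hv, hv']
        | tmul a' b' => simp

/-- Transport of multipliers along a multiplicative linear isomorphism. -/
def transport (e : A ≃ₗ[ℂ] B) (he : ∀ x y, e (x * y) = e x * e y) (m : MultiplierAlgebra B) :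
    MultiplierAlgebra A :=
  mkMultiplier (e.symm.toLinearMap ∘ₗ lact m ∘ₗ e.toLinearMap)
    (e.symm.toLinearMap ∘ₗ ract m ∘ₗ e.toLinearMap)
    (fun x y => e.injective (by simp [he, lact_mul_right]))
    (fun x y => e.injective (by simp [he, ract_mul_left]))
    (fun x y => e.injective (by simp [he, ract_mul_eq]))

/-- `E₁₂ = E ⊗ 1` in `M(A ⊗ A ⊗ A)`. -/
def leg12 (E : MultiplierAlgebra (A ⊗[ℂ] A)) : MultiplierAlgebra ((A ⊗[ℂ] A) ⊗[ℂ] A) :=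
  tmulMultiplier E 1

/-- `E₂₃ = 1 ⊗ E` in `M(A ⊗ A ⊗ A)`. -/
def leg23 (E : MultiplierAlgebra (A ⊗[ℂ] A)) : MultiplierAlgebra ((A ⊗[ℂ] A) ⊗[ℂ] A) :=
  transport (TensorProduct.assoc ℂ A A A) assoc_mul
    (tmulMultiplier 1 E)

/-- `ι ⊗ φ : A ⊗ A → A`. -/
def sliceRight (φ : A →ₗ[ℂ] ℂ) : A ⊗[ℂ] A →ₗ[ℂ] A :=
  (TensorProduct.rid ℂ A).toLinearMap ∘ₗ φ.lTensor A

/-- `ψ ⊗ ι : A ⊗ A → A`. -/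
def sliceLeft (ψ : A →ₗ[ℂ] ℂ) : A ⊗[ℂ] A →ₗ[ℂ] A :=
  (TensorProduct.lid ℂ A).toLinearMap ∘ₗ ψ.rTensor A

end Multipliers

section Coproducts

/-- The product of `A` is non-degenerate and `A = A²`. -/
structure IsNondegenerateIdempotent (A : Type*) [NonUnitalRing A] [Module ℂ A] : Prop where
  eq_zero_of_mul_right : ∀ a : A, (∀ b : A, a * b = 0) → a = 0
  eq_zero_of_mul_left : ∀ a : A, (∀ b : A, b * a = 0) → a = 0
  span_mul : Submodule.span ℂ {x : A | ∃ a b : A, x = a * b} = ⊤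

/-- A regular coproduct on `A`: a coassociative homomorphism `Δ : A → M(A ⊗ A)` such that
`Δ(a)(1 ⊗ b)`, `(c ⊗ 1)Δ(a)`, `(1 ⊗ b)Δ(a)` and `Δ(a)(c ⊗ 1)` all lie in `A ⊗ A`. The elements of
`A ⊗ A` in question are the values of the four canonical maps, which are recorded as fields; when
the product of `A` is non-degenerate they are uniquely determined by `Δ`. -/
structure RegularCoproduct (A : Type*) [NonUnitalRing A] [Module ℂ A] [IsScalarTower ℂ A A]
    [SMulCommClass ℂ A A] where
  /-- the homomorphism `Δ : A → M(A ⊗ A)` -/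
  Δ : A →ₙₐ[ℂ] MultiplierAlgebra (A ⊗[ℂ] A)
  /-- `T₁(a ⊗ b) = Δ(a)(1 ⊗ b)` -/
  T₁ : A ⊗[ℂ] A →ₗ[ℂ] A ⊗[ℂ] A
  /-- `T₂(c ⊗ a) = (c ⊗ 1)Δ(a)` -/
  T₂ : A ⊗[ℂ] A →ₗ[ℂ] A ⊗[ℂ] A
  /-- `T₃(a ⊗ b) = (1 ⊗ b)Δ(a)` -/
  T₃ : A ⊗[ℂ] A →ₗ[ℂ] A ⊗[ℂ] A
  /-- `T₄(c ⊗ a) = Δ(a)(c ⊗ 1)` -/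
  T₄ : A ⊗[ℂ] A →ₗ[ℂ] A ⊗[ℂ] A
  T₁_spec : ∀ a b : A, of (A ⊗[ℂ] A) (T₁ (a ⊗ₜ b)) = Δ a * tmulMultiplier 1 (of A b)
  T₂_spec : ∀ c a : A, of (A ⊗[ℂ] A) (T₂ (c ⊗ₜ a)) = tmulMultiplier (of A c) 1 * Δ a
  T₃_spec : ∀ a b : A, of (A ⊗[ℂ] A) (T₃ (a ⊗ₜ b)) = tmulMultiplier 1 (of A b) * Δ a
  T₄_spec : ∀ c a : A, of (A ⊗[ℂ] A) (T₄ (c ⊗ₜ a)) = Δ a * tmulMultiplier (of A c) 1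
  /-- `(c ⊗ 1 ⊗ 1)(Δ ⊗ ι)(Δ(a)(1 ⊗ b)) = (ι ⊗ Δ)((c ⊗ 1)Δ(a))(1 ⊗ 1 ⊗ b)` in `A ⊗ A ⊗ A`. -/
  coassoc : ∀ a b c : A,
    TensorProduct.assoc ℂ A A A
        ((T₂ ∘ₗ TensorProduct.mk ℂ A A c).rTensor A (T₁ (a ⊗ₜ b))) =
      (T₁ ∘ₗ (TensorProduct.mk ℂ A A).flip b).lTensor A (T₂ (c ⊗ₜ a))

variable {A : Type*} [NonUnitalRing A] [Module ℂ A] [IsScalarTower ℂ A A] [SMulCommClass ℂ A A]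

/-- The coproduct is full: `Δ(A)(1 ⊗ A) ⊆ V ⊗ A` forces `V = A`, and `(A ⊗ 1)Δ(A) ⊆ A ⊗ W`
forces `W = A`. -/
structure RegularCoproduct.IsFull (D : RegularCoproduct A) : Prop where
  left : ∀ V : Submodule ℂ A,
    (∀ a b : A, D.T₁ (a ⊗ₜ b) ∈ LinearMap.range (V.subtype.rTensor A)) → V = ⊤
  right : ∀ W : Submodule ℂ A,
    (∀ c a : A, D.T₂ (c ⊗ₜ a) ∈ LinearMap.range (W.subtype.lTensor A)) → W = ⊤

/-- `E` is the canonical idempotent: `E² = E`, `Δ(A)(A ⊗ A) = E(A ⊗ A)` and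
`(A ⊗ A)Δ(A) = (A ⊗ A)E`. -/
structure RegularCoproduct.IsCanonicalIdempotent (D : RegularCoproduct A)
    (E : MultiplierAlgebra (A ⊗[ℂ] A)) : Prop where
  idem : E * E = E
  range_left : Submodule.span ℂ {y | ∃ (a : A) (x : A ⊗[ℂ] A), y = lact (D.Δ a) x} =
    LinearMap.range (lact E)
  range_right : Submodule.span ℂ {y | ∃ (a : A) (x : A ⊗[ℂ] A), y = ract (D.Δ a) x} =
    LinearMap.range (ract E)

/-- The homomorphism `Δ ⊗ ι : A ⊗ A → M(A ⊗ A ⊗ A)`, `a ⊗ b ↦ Δ(a) ⊗ b`. -/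
noncomputable def RegularCoproduct.deltaTensorId (D : RegularCoproduct A) :
    A ⊗[ℂ] A →ₗ[ℂ] MultiplierAlgebra ((A ⊗[ℂ] A) ⊗[ℂ] A) :=
  TensorProduct.lift
    ((tmulBilin (A ⊗[ℂ] A) A).compl₁₂ (D.Δ : A →ₗ[ℂ] MultiplierAlgebra (A ⊗[ℂ] A))
      (of A : A →ₗ[ℂ] MultiplierAlgebra A))

/-- `n` is the value at `m ∈ M(A ⊗ A)` of the extension of `Δ ⊗ ι` to `M(A ⊗ A)`: this extension is
the unique homomorphism with `(Δ ⊗ ι)(m) = (E ⊗ 1)((Δ ⊗ ι)(m)) = ((Δ ⊗ ι)(m))(E ⊗ 1)`, and its value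
at `m` is the only multiplier with the properties below. -/
structure RegularCoproduct.IsExtendedValue (D : RegularCoproduct A)
    (E m : MultiplierAlgebra (A ⊗[ℂ] A)) (n : MultiplierAlgebra ((A ⊗[ℂ] A) ⊗[ℂ] A)) : Prop where
  mul_left : ∀ x : A ⊗[ℂ] A, n * D.deltaTensorId x = D.deltaTensorId (lact m x)
  mul_right : ∀ x : A ⊗[ℂ] A, D.deltaTensorId x * n = D.deltaTensorId (ract m x)
  unit_left : leg12 E * n = n
  unit_right : n * leg12 E = n

/-- Weak comultiplicativity of the unit: `(Δ ⊗ ι)E = (E ⊗ 1)(1 ⊗ E) = (1 ⊗ E)(E ⊗ 1)`. -/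
structure RegularCoproduct.IsWeaklyComultiplicative (D : RegularCoproduct A)
    (E : MultiplierAlgebra (A ⊗[ℂ] A)) : Prop where
  extension : D.IsExtendedValue E E (leg12 E * leg23 E)
  comm : leg12 E * leg23 E = leg23 E * leg12 E

/-- A subalgebra `B` of `M(A)` sits in it in a non-degenerate way: `BA = AB = A`. -/
structure SitsNondegenerately (B : NonUnitalSubalgebra ℂ (MultiplierAlgebra A)) : Prop where
  left : Submodule.span ℂ {y : A | ∃ x ∈ B, ∃ a : A, y = lact x a} = ⊤
  right : Submodule.span ℂ {y : A | ∃ x ∈ B, ∃ a : A, y = ract x a} = ⊤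

/-- `V ⊗ W` for subspaces `V, W` of `M(A)`, as a subspace of `M(A ⊗ A)`. -/
def tensorSpan (V W : Submodule ℂ (MultiplierAlgebra A)) :
    Submodule ℂ (MultiplierAlgebra (A ⊗[ℂ] A)) :=
  Submodule.span ℂ {u | ∃ x ∈ V, ∃ y ∈ W, u = tmulMultiplier x y}

/-- `E` lies in `M(B ⊗ C)` and is a regular separability idempotent there; `B` and `C` are
subalgebras of `M(A)`. The left and right leg of `E` are required to be all of `B` and of `C`. -/
structure IsRegularSeparabilityIdempotent (B C : NonUnitalSubalgebra ℂ (MultiplierAlgebra A))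
    (E : MultiplierAlgebra (A ⊗[ℂ] A)) : Prop where
  idem : E * E = E
  mem_left : ∀ u ∈ tensorSpan B.toSubmodule C.toSubmodule,
    E * u ∈ tensorSpan B.toSubmodule C.toSubmodule
  mem_right : ∀ u ∈ tensorSpan B.toSubmodule C.toSubmodule,
    u * E ∈ tensorSpan B.toSubmodule C.toSubmodule
  cover₁ : ∀ y ∈ C, E * tmulMultiplier 1 y ∈ tensorSpan B.toSubmodule C.toSubmodule
  cover₂ : ∀ x ∈ B, tmulMultiplier x 1 * E ∈ tensorSpan B.toSubmodule C.toSubmodule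
  cover₃ : ∀ y ∈ C, tmulMultiplier 1 y * E ∈ tensorSpan B.toSubmodule C.toSubmodule
  cover₄ : ∀ x ∈ B, E * tmulMultiplier x 1 ∈ tensorSpan B.toSubmodule C.toSubmodule
  full_left : ∀ V : Submodule ℂ (MultiplierAlgebra A), V ≤ B.toSubmodule →
    (∀ y ∈ C, E * tmulMultiplier 1 y ∈ tensorSpan V C.toSubmodule) → V = B.toSubmodule
  full_right : ∀ W : Submodule ℂ (MultiplierAlgebra A), W ≤ C.toSubmodule →
    (∀ x ∈ B, E * tmulMultiplier x 1 ∈ tensorSpan B.toSubmodule W) → W = C.toSubmodule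
  /-- `E(B ⊗ 1) = E(1 ⊗ C)` -/
  regular_left : {u | ∃ x ∈ B, u = E * tmulMultiplier x 1} =
    {u | ∃ y ∈ C, u = E * tmulMultiplier 1 y}
  /-- `(B ⊗ 1)E = (1 ⊗ C)E` -/
  regular_right : {u | ∃ x ∈ B, u = tmulMultiplier x 1 * E} =
    {u | ∃ y ∈ C, u = tmulMultiplier 1 y * E}

/-- The multiplier algebra `M(B)` of a subalgebra `B` sitting non-degenerately in `M(A)`, regarded
as a subset of `M(A)`. -/
def multipliersOf (B : NonUnitalSubalgebra ℂ (MultiplierAlgebra A)) :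
    Set (MultiplierAlgebra A) :=
  {m | ∀ x ∈ B, m * x ∈ B ∧ x * m ∈ B}

/-- A left integral: a non-zero linear functional `φ` with `(ι ⊗ φ)Δ(a) ∈ A_t = M(C)` for all `a`.
Here `y = (ι ⊗ φ)Δ(a)` is the multiplier of `A` with `y c = (ι ⊗ φ)(Δ(a)(c ⊗ 1))` and
`c y = (ι ⊗ φ)((c ⊗ 1)Δ(a))`. -/
def RegularCoproduct.IsLeftIntegral (D : RegularCoproduct A)
    (C : NonUnitalSubalgebra ℂ (MultiplierAlgebra A)) (φ : A →ₗ[ℂ] ℂ) : Prop :=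
  φ ≠ 0 ∧ ∀ a : A, ∃ y ∈ multipliersOf C,
    (∀ c : A, lact y c = sliceRight φ (D.T₄ (c ⊗ₜ a))) ∧
    (∀ c : A, ract y c = sliceRight φ (D.T₂ (c ⊗ₜ a)))

/-- A right integral: a non-zero linear functional `ψ` with `(ψ ⊗ ι)Δ(a) ∈ A_s = M(B)` for all `a`.
Here `x = (ψ ⊗ ι)Δ(a)` is the multiplier of `A` with `x b = (ψ ⊗ ι)(Δ(a)(1 ⊗ b))` and
`b x = (ψ ⊗ ι)((1 ⊗ b)Δ(a))`. -/
def RegularCoproduct.IsRightIntegral (D : RegularCoproduct A)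
    (B : NonUnitalSubalgebra ℂ (MultiplierAlgebra A)) (ψ : A →ₗ[ℂ] ℂ) : Prop :=
  ψ ≠ 0 ∧ ∀ a : A, ∃ x ∈ multipliersOf B,
    (∀ b : A, lact x b = sliceLeft ψ (D.T₁ (a ⊗ₜ b))) ∧
    (∀ b : A, ract x b = sliceLeft ψ (D.T₃ (a ⊗ₜ b)))

/-- A set of linear functionals on `A` is faithful. -/
def IsFaithfulSet (F : Set (A →ₗ[ℂ] ℂ)) : Prop :=
  (∀ a : A, (∀ φ ∈ F, ∀ b : A, φ (a * b) = 0) → a = 0) ∧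
  (∀ a : A, (∀ φ ∈ F, ∀ b : A, φ (b * a) = 0) → a = 0)

/-- The map `b ⊗ c ↦ Δ₁₃(a)(1 ⊗ b ⊗ c)` from `A ⊗ A` to `A ⊗ A ⊗ A`; that is,
`b ⊗ c ↦ ∑ p ⊗ b ⊗ q` where `Δ(a)(1 ⊗ c) = ∑ p ⊗ q`. -/
noncomputable def RegularCoproduct.delta13 (D : RegularCoproduct A) (a : A) :
    A ⊗[ℂ] A →ₗ[ℂ] (A ⊗[ℂ] A) ⊗[ℂ] A :=
  TensorProduct.lift
    ((LinearMap.rTensorHom A ∘ₗ (TensorProduct.mk ℂ A A).flip).compl₂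
      (D.T₁ ∘ₗ TensorProduct.mk ℂ A A a))

/-- The map `m ↦ m b` from `M(A)` to `A`. -/
def actOn (b : A) : MultiplierAlgebra A →ₗ[ℂ] A where
  toFun m := lact m b
  map_add' _ _ := rfl
  map_smul' _ _ := rfl

/-- `S : A → M(A)` is the antipode of the weak multiplier Hopf algebra `(A, Δ)` with canonical
idempotent `E`. The projections on the range and along the kernel of `T₁` are left multiplication
by `E` and the map `G₁` determined by
`(G₁ ⊗ ι)(Δ₁₃(a)(1 ⊗ b ⊗ c)) = Δ₁₃(a)(1 ⊗ E)(1 ⊗ b ⊗ c)`; the generalized inverse `R₁` of `T₁` is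
given by `T₁R₁ = E ·`, `R₁T₁ = G₁` and `R₁T₁R₁ = R₁`; and the antipode is given by
`R₁(a ⊗ b) = ∑ a₍₁₎ ⊗ S(a₍₂₎)b`, a formula that has to be covered by `c` in the first factor. -/
def RegularCoproduct.IsAntipode (D : RegularCoproduct A) (E : MultiplierAlgebra (A ⊗[ℂ] A))
    (S : A →ₗ[ℂ] MultiplierAlgebra A) : Prop :=
  ∃ G₁ R₁ : A ⊗[ℂ] A →ₗ[ℂ] A ⊗[ℂ] A,
    (∀ (a : A) (x : A ⊗[ℂ] A), G₁.rTensor A (D.delta13 a x) = D.delta13 a (lact E x)) ∧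
    (∀ x, D.T₁ (R₁ x) = lact E x) ∧
    (∀ x, R₁ (D.T₁ x) = G₁ x) ∧
    (∀ x, R₁ (D.T₁ (R₁ x)) = R₁ x) ∧
    (∀ a b c : A, lact (tmulMultiplier (of A c) 1) (R₁ (a ⊗ₜ b)) =
      (actOn b ∘ₗ S).lTensor A (D.T₂ (c ⊗ₜ a)))

end Coproducts

end WMHA

/-!
Write `y(v) = (ι ⊗ φ)Δ(v) ∈ M(C)` for the left integral `φ`, and
`X = (ι ⊗ ι ⊗ φ)(Δ₁₃(a)(1 ⊗ Δ(b)(c ⊗ 1)))`, that is,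
`X = ∑ a₍₁₎ ⊗ (ι ⊗ φ)((1 ⊗ a₍₂₎)Δ(b))c`. The proof shows `R₁(p ⊗ c) = X`. Since
`(d ⊗ 1)R₁(p ⊗ c) = ∑ d p₍₁₎ ⊗ S(p₍₂₎)c` and, by coassociativity,
`(d ⊗ 1)Δ(p) = ∑ d a₍₁₎ ⊗ (ι ⊗ φ)(Δ(a₍₂₎)(1 ⊗ b))`, fullness of the coproduct then allows one to
remove the first leg, which leaves the assertion multiplied by `c`.

Because `EΔ(b) = Δ(b)`, the defining property of `G₁` gives `G₁(X) = X`, so that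
`R₁(p ⊗ c) = R₁(E(p ⊗ c)) = R₁(T₁(X)) = G₁(X) = X` once `T₁(X) = E(p ⊗ c)` is known. By
coassociativity (`T₁_delta13`), `T₁(X) = (ι ⊗ y)(w)(1 ⊗ c)` with `w = Δ(a)(1 ⊗ b)`, and what remains
is the identity `(ι ⊗ y)(w) = E((ι ⊗ φ)(w) ⊗ 1)` for `w ∈ E(A ⊗ A)`
(`RegularCoproduct.IsLeftIntegral.lTensor_lact`). It rests on two facts.

* For `w = Δ(v)(d ⊗ 1)` it says that `(ι ⊗ y)Δ(v) = Δ(y(v)) = E(y(v) ⊗ 1)`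
  (`RegularCoproduct.IsLeftIntegral.lTensor_T₄`). The second equality is valid for every element of
  `M(C)`; it comes from `(ι ⊗ Δ)(E) = E₁₂E₂₃` (`lact_leg12_idTensorDelta`), which is deduced from the
  assumption on `(Δ ⊗ ι)(E)`, together with the fullness of the right leg of `E`.
* The flipped idempotent `F = (σ ⊗ ι)E`, with `σ : B → C` determined by `E(x ⊗ 1) = E(1 ⊗ σ(x))`,
  satisfies `E₁₂E₁₃ = F₂₃E₁₃` (`IsRegularSeparabilityIdempotent.exists_flip_lTensor`). Applying `φ`
  to the third leg, one obtains `E((ι ⊗ φ)(w) ⊗ 1) = (ι ⊗ f)(w)` for all `w ∈ E(A ⊗ A)`, where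
  `f(v) = (ι ⊗ φ)(F(1 ⊗ v))`.

Comparing the two for `w = Δ(v)(d ⊗ 1)` and using fullness gives `f = y`, hence the identity for all
`w ∈ E(A ⊗ A)`.

Multipliers of `A ⊗ A` and `A ⊗ A ⊗ A` are handled through their left actions, and identities are
checked after multiplication by elements of one leg, which is harmless as the products of `A`,
`A ⊗ A` and `A ⊗ A ⊗ A` are non-degenerate.
-/

set_option linter.unusedSectionVars false

namespace WMHA

/-! ### Tensor products of vector spaces -/

section TensorProducts

variable {U U' V W W' : Type*} [AddCommGroup U] [Module ℂ U] [AddCommGroup U'] [Module ℂ U']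
  [AddCommGroup V] [Module ℂ V] [AddCommGroup W] [Module ℂ W] [AddCommGroup W'] [Module ℂ W']

theorem eq_zero_of_left_slices (z : V ⊗[ℂ] W)
    (h : ∀ ω : V →ₗ[ℂ] ℂ, TensorProduct.lid ℂ W (ω.rTensor W z) = 0) : z = 0 := by
  classical
  let b := Module.Basis.ofVectorSpace ℂ V
  apply (TensorProduct.equivFinsuppOfBasisLeft b).injective
  rw [map_zero]
  ext i
  rw [TensorProduct.equivFinsuppOfBasisLeft_apply]
  simpa using h (b.coord i)

/-- A jointly injective family of linear maps stays jointly injective after applying `U ⊗ -`. -/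
theorem lTensor_separates {ι : Sort*} (L : ι → V →ₗ[ℂ] W) (hL : ∀ v, (∀ i, L i v = 0) → v = 0)
    (z : U ⊗[ℂ] V) (h : ∀ i, (L i).lTensor U z = 0) : z = 0 := by
  refine eq_zero_of_left_slices z fun ω => hL _ fun i => ?_
  have key : L i ∘ₗ (TensorProduct.lid ℂ V).toLinearMap ∘ₗ ω.rTensor V =
      (TensorProduct.lid ℂ W).toLinearMap ∘ₗ ω.rTensor W ∘ₗ (L i).lTensor U :=
    TensorProduct.ext' fun u v => by simp
  have := LinearMap.congr_fun key z
  simp only [LinearMap.comp_apply, h i, map_zero] at this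
  exact this

theorem rTensor_separates {ι : Sort*} (L : ι → V →ₗ[ℂ] W) (hL : ∀ v, (∀ i, L i v = 0) → v = 0)
    (z : V ⊗[ℂ] U) (h : ∀ i, (L i).rTensor U z = 0) : z = 0 := by
  apply (TensorProduct.comm ℂ V U).injective
  rw [map_zero]
  refine lTensor_separates L hL _ fun i => ?_
  have key : (L i).lTensor U ∘ₗ (TensorProduct.comm ℂ V U).toLinearMap =
      (TensorProduct.comm ℂ W U).toLinearMap ∘ₗ (L i).rTensor U :=
    TensorProduct.ext' fun u v => by simp
  have := LinearMap.congr_fun key z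
  simpa [h i] using this

theorem mem_range_lTensor_ker (f : V →ₗ[ℂ] W) (z : U ⊗[ℂ] V) (h : f.lTensor U z = 0) :
    z ∈ LinearMap.range ((LinearMap.ker f).subtype.lTensor U) :=
  (Module.Flat.lTensor_exact U f.exact_subtype_ker_map z).1 h

theorem rTensor_assoc (f : U →ₗ[ℂ] U') (z : (U ⊗[ℂ] V) ⊗[ℂ] W) :
    f.rTensor (V ⊗[ℂ] W) (TensorProduct.assoc ℂ U V W z) =
      TensorProduct.assoc ℂ U' V W ((f.rTensor V).rTensor W z) :=
  LinearMap.congr_fun (f := f.rTensor (V ⊗[ℂ] W) ∘ₗ (TensorProduct.assoc ℂ U V W).toLinearMap)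
    (g := (TensorProduct.assoc ℂ U' V W).toLinearMap ∘ₗ (f.rTensor V).rTensor W)
    (TensorProduct.ext_threefold fun _ _ _ => rfl) z

theorem rTensor_lTensor_comm (f : U →ₗ[ℂ] U') (g : V →ₗ[ℂ] W) (z : U ⊗[ℂ] V) :
    f.rTensor W (g.lTensor U z) = g.lTensor U' (f.rTensor V z) := by
  rw [← LinearMap.comp_apply, LinearMap.rTensor_comp_lTensor, ← LinearMap.lTensor_comp_rTensor,
    LinearMap.comp_apply]

theorem assoc_symm_lTensor_lTensor (f : W →ₗ[ℂ] W') (z : U ⊗[ℂ] (V ⊗[ℂ] W)) :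
    f.lTensor (U ⊗[ℂ] V) ((TensorProduct.assoc ℂ U V W).symm z) =
      (TensorProduct.assoc ℂ U V W').symm ((f.lTensor V).lTensor U z) :=
  LinearMap.congr_fun
    (f := f.lTensor (U ⊗[ℂ] V) ∘ₗ (TensorProduct.assoc ℂ U V W).symm.toLinearMap)
    (g := (TensorProduct.assoc ℂ U V W').symm.toLinearMap ∘ₗ (f.lTensor V).lTensor U)
    (TensorProduct.ext_threefold' fun _ _ _ => by simp) z

end TensorProducts

/-! ### Multipliers and non-degenerate products -/

section Multipliers

variable {A : Type*} [NonUnitalRing A] [Module ℂ A] [IsScalarTower ℂ A A] [SMulCommClass ℂ A A]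
variable {B : Type*} [NonUnitalRing B] [Module ℂ B] [IsScalarTower ℂ B B] [SMulCommClass ℂ B B]

@[simp] theorem lact_mul (m n : MultiplierAlgebra A) (a : A) :
    lact (m * n) a = lact m (lact n a) := rfl

@[simp] theorem ract_mul (m n : MultiplierAlgebra A) (a : A) :
    ract (m * n) a = ract n (ract m a) := rfl

@[simp] theorem lact_one (a : A) : lact (1 : MultiplierAlgebra A) a = a := rfl

@[simp] theorem ract_one (a : A) : ract (1 : MultiplierAlgebra A) a = a := rfl

@[simp] theorem lact_of (a b : A) : lact (of A a) b = a * b := rfl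

@[simp] theorem ract_of (a b : A) : ract (of A a) b = b * a := rfl

@[simp] theorem actOn_apply (b : A) (m : MultiplierAlgebra A) : actOn b m = lact m b := rfl

theorem of_lact (m : MultiplierAlgebra A) (a : A) : of A (lact m a) = m * of A a :=
  ext_multiplier (fun b => (lact_mul_right m a b).symm) (fun b => (ract_mul_eq m b a).symm)

theorem of_ract (m : MultiplierAlgebra A) (a : A) : of A (ract m a) = of A a * m :=
  ext_multiplier (fun b => ract_mul_eq m a b) (fun b => (ract_mul_left m b a).symm)

@[simp] theorem lact_tmul (m : MultiplierAlgebra A) (n : MultiplierAlgebra B) (a : A) (b : B) :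
    lact (tmulMultiplier m n) (a ⊗ₜ[ℂ] b) = lact m a ⊗ₜ[ℂ] lact n b := rfl

@[simp] theorem ract_tmul (m : MultiplierAlgebra A) (n : MultiplierAlgebra B) (a : A) (b : B) :
    ract (tmulMultiplier m n) (a ⊗ₜ[ℂ] b) = ract m a ⊗ₜ[ℂ] ract n b := rfl

theorem tmulMultiplier_mul (m m' : MultiplierAlgebra A) (n n' : MultiplierAlgebra B) :
    tmulMultiplier m n * tmulMultiplier m' n' = tmulMultiplier (m * m') (n * n') := by
  refine ext_multiplier (fun x => ?_) (fun x => ?_)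
  · rw [lact_mul]
    induction x with
    | zero => simp
    | add x y hx hy => simp only [map_add, hx, hy]
    | tmul a b => simp
  · rw [ract_mul]
    induction x with
    | zero => simp
    | add x y hx hy => simp only [map_add, hx, hy]
    | tmul a b => simp

theorem of_tmul (a : A) (b : B) :
    of (A ⊗[ℂ] B) (a ⊗ₜ[ℂ] b) = tmulMultiplier (of A a) (of B b) := by
  refine ext_multiplier (fun x => ?_) (fun x => ?_)
  · induction x with
    | zero => simp
    | add x y hx hy => simp only [map_add, hx, hy]
    | tmul a b => simp
  · induction x with
    | zero => simp
    | add x y hx hy => simp only [map_add, hx, hy]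
    | tmul a b => simp

theorem IsNondegenerateIdempotent.of_injective (hA : IsNondegenerateIdempotent A) :
    Function.Injective (of A) := by
  refine (injective_iff_map_eq_zero _).2 fun a ha => hA.eq_zero_of_mul_right a fun b => ?_
  exact congrArg (fun m => lact m b) ha

theorem IsNondegenerateIdempotent.lact_injective (hA : IsNondegenerateIdempotent A)
    {m n : MultiplierAlgebra A} (h : ∀ a, lact m a = lact n a) : m = n := by
  refine ext_multiplier h fun a => sub_eq_zero.1 (hA.eq_zero_of_mul_right _ fun b => ?_)
  rw [sub_mul, ract_mul_eq, ract_mul_eq, h, sub_self]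

theorem IsNondegenerateIdempotent.linearMap_ext (hA : IsNondegenerateIdempotent A)
    {V : Type*} [AddCommGroup V] [Module ℂ V] {f g : A →ₗ[ℂ] V}
    (h : ∀ a b, f (a * b) = g (a * b)) : f = g := by
  refine LinearMap.ext_on hA.span_mul ?_
  rintro _ ⟨a, b, rfl⟩
  exact h a b

theorem IsNondegenerateIdempotent.tensor (hA : IsNondegenerateIdempotent A)
    (hB : IsNondegenerateIdempotent B) : IsNondegenerateIdempotent (A ⊗[ℂ] B) where
  eq_zero_of_mul_right z hz := by
    refine rTensor_separates (fun b : A => LinearMap.mulRight ℂ b)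
      (fun a h => hA.eq_zero_of_mul_right a h) z fun a => ?_
    refine lTensor_separates (fun b : B => LinearMap.mulRight ℂ b)
      (fun a h => hB.eq_zero_of_mul_right a h) _ fun b => ?_
    have key : (LinearMap.mulRight ℂ b).lTensor A ∘ₗ (LinearMap.mulRight ℂ a).rTensor B =
        LinearMap.mulRight ℂ (a ⊗ₜ[ℂ] b) := TensorProduct.ext' fun u v => by simp
    exact (LinearMap.congr_fun key z).trans (hz _)
  eq_zero_of_mul_left z hz := by
    refine rTensor_separates (fun b : A => LinearMap.mulLeft ℂ b)
      (fun a h => hA.eq_zero_of_mul_left a h) z fun a => ?_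
    refine lTensor_separates (fun b : B => LinearMap.mulLeft ℂ b)
      (fun a h => hB.eq_zero_of_mul_left a h) _ fun b => ?_
    have key : (LinearMap.mulLeft ℂ b).lTensor A ∘ₗ (LinearMap.mulLeft ℂ a).rTensor B =
        LinearMap.mulLeft ℂ (a ⊗ₜ[ℂ] b) := TensorProduct.ext' fun u v => by simp
    exact (LinearMap.congr_fun key z).trans (hz _)
  span_mul := by
    let K := Submodule.span ℂ {x : A ⊗[ℂ] B | ∃ a b : A ⊗[ℂ] B, x = a * b}
    have h2 : (TensorProduct.mk ℂ A B).compr₂ K.mkQ = 0 := by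
      refine hA.linearMap_ext fun a a' => hB.linearMap_ext fun b b' => ?_
      refine (Submodule.Quotient.mk_eq_zero K).2 (Submodule.subset_span ⟨a ⊗ₜ b, a' ⊗ₜ b', ?_⟩)
      simp
    have h : K.mkQ = 0 := TensorProduct.ext h2
    change K = ⊤
    rw [← K.ker_mkQ, h, LinearMap.ker_zero]

theorem IsNondegenerateIdempotent.lTensor_mulRight_separates (hA : IsNondegenerateIdempotent A)
    {U : Type*} [AddCommGroup U] [Module ℂ U] {x y : U ⊗[ℂ] A}
    (h : ∀ a : A, (LinearMap.mulRight ℂ a).lTensor U x = (LinearMap.mulRight ℂ a).lTensor U y) :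
    x = y :=
  sub_eq_zero.1 <| lTensor_separates (fun a : A => LinearMap.mulRight ℂ a)
    (fun a h => hA.eq_zero_of_mul_right a h) _ fun a => by rw [map_sub, h, sub_self]

theorem IsNondegenerateIdempotent.rTensor_mulRight_separates (hA : IsNondegenerateIdempotent A)
    {U : Type*} [AddCommGroup U] [Module ℂ U] {x y : A ⊗[ℂ] U}
    (h : ∀ a : A, (LinearMap.mulRight ℂ a).rTensor U x = (LinearMap.mulRight ℂ a).rTensor U y) :
    x = y :=
  sub_eq_zero.1 <| rTensor_separates (fun a : A => LinearMap.mulRight ℂ a)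
    (fun a h => hA.eq_zero_of_mul_right a h) _ fun a => by rw [map_sub, h, sub_self]

theorem IsNondegenerateIdempotent.rTensor_mulLeft_separates (hA : IsNondegenerateIdempotent A)
    {U : Type*} [AddCommGroup U] [Module ℂ U] {x y : A ⊗[ℂ] U}
    (h : ∀ a : A, (LinearMap.mulLeft ℂ a).rTensor U x = (LinearMap.mulLeft ℂ a).rTensor U y) :
    x = y :=
  sub_eq_zero.1 <| rTensor_separates (fun a : A => LinearMap.mulLeft ℂ a)
    (fun a h => hA.eq_zero_of_mul_left a h) _ fun a => by rw [map_sub, h, sub_self]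

end Multipliers

/-! ### The canonical maps of a regular coproduct -/

section Coproducts

variable {A : Type*} [NonUnitalRing A] [Module ℂ A] [IsScalarTower ℂ A A] [SMulCommClass ℂ A A]

namespace RegularCoproduct

variable (D : RegularCoproduct A)

/-- The bilinear map `(t, a) ↦ Δ(a)t`. -/
def deltaAct : A ⊗[ℂ] A →ₗ[ℂ] A →ₗ[ℂ] A ⊗[ℂ] A :=
  LinearMap.mk₂ ℂ (fun t a => lact (D.Δ a) t) (fun _ _ _ => map_add _ _ _)
    (fun _ _ _ => map_smul _ _ _) (fun t a b => by rw [map_add]; rfl)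
    (fun c t a => by rw [map_smul]; rfl)

@[simp] theorem deltaAct_apply (t : A ⊗[ℂ] A) (a : A) : D.deltaAct t a = lact (D.Δ a) t := rfl

theorem lact_delta_mul (a b : A) (x : A ⊗[ℂ] A) :
    lact (D.Δ (a * b)) x = lact (D.Δ a) (lact (D.Δ b) x) := by rw [map_mul, lact_mul]


theorem lTensor_mulRight_T₄ (hA : IsNondegenerateIdempotent A) (u a b : A) :
    (LinearMap.mulRight ℂ b).lTensor A (D.T₄ (u ⊗ₜ a)) = lact (D.Δ a) (u ⊗ₜ b) := by
  apply (hA.tensor hA).of_injective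
  have h := of_ract (tmulMultiplier 1 (of A b)) (D.T₄ (u ⊗ₜ a))
  refine h.trans ?_
  rw [T₄_spec, of_lact, of_tmul, mul_assoc, tmulMultiplier_mul, one_mul, mul_one]

theorem rTensor_mulRight_T₁ (hA : IsNondegenerateIdempotent A) (u a b : A) :
    (LinearMap.mulRight ℂ u).rTensor A (D.T₁ (a ⊗ₜ b)) = lact (D.Δ a) (u ⊗ₜ b) := by
  apply (hA.tensor hA).of_injective
  have h := of_ract (tmulMultiplier (of A u) 1) (D.T₁ (a ⊗ₜ b))
  refine h.trans ?_
  rw [T₁_spec, of_lact, of_tmul, mul_assoc, tmulMultiplier_mul, one_mul, mul_one]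

theorem rTensor_mulRight_T₂ (hA : IsNondegenerateIdempotent A) (c a d : A) :
    (LinearMap.mulRight ℂ d).rTensor A (D.T₂ (c ⊗ₜ a)) =
      (LinearMap.mulLeft ℂ c).rTensor A (D.T₄ (d ⊗ₜ a)) := by
  apply (hA.tensor hA).of_injective
  have h := of_ract (tmulMultiplier (of A d) 1) (D.T₂ (c ⊗ₜ a))
  have h' := of_lact (tmulMultiplier (of A c) 1) (D.T₄ (d ⊗ₜ a))
  refine h.trans (Eq.trans ?_ h'.symm)
  rw [T₂_spec, T₄_spec, mul_assoc]

theorem lTensor_mulRight_T₂ (hA : IsNondegenerateIdempotent A) (c a b : A) :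
    (LinearMap.mulRight ℂ b).lTensor A (D.T₂ (c ⊗ₜ a)) =
      (LinearMap.mulLeft ℂ c).rTensor A (D.T₁ (a ⊗ₜ b)) := by
  apply (hA.tensor hA).of_injective
  have h := of_ract (tmulMultiplier 1 (of A b)) (D.T₂ (c ⊗ₜ a))
  have h' := of_lact (tmulMultiplier (of A c) 1) (D.T₁ (a ⊗ₜ b))
  refine h.trans (Eq.trans ?_ h'.symm)
  rw [T₂_spec, T₁_spec, mul_assoc]

theorem lTensor_mulLeft_T₄ (hA : IsNondegenerateIdempotent A) (c b s : A) :
    (LinearMap.mulLeft ℂ s).lTensor A (D.T₄ (c ⊗ₜ b)) =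
      (LinearMap.mulRight ℂ c).rTensor A (D.T₃ (b ⊗ₜ s)) := by
  apply (hA.tensor hA).of_injective
  have h := of_lact (tmulMultiplier 1 (of A s)) (D.T₄ (c ⊗ₜ b))
  have h' := of_ract (tmulMultiplier (of A c) 1) (D.T₃ (b ⊗ₜ s))
  refine h.trans (Eq.trans ?_ h'.symm)
  rw [T₄_spec, T₃_spec, mul_assoc]

theorem lTensor_mulRight_T₁ (hA : IsNondegenerateIdempotent A) (a b q : A) :
    (LinearMap.mulRight ℂ q).lTensor A (D.T₁ (a ⊗ₜ b)) = D.T₁ (a ⊗ₜ (b * q)) := by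
  apply (hA.tensor hA).of_injective
  have h := of_ract (tmulMultiplier 1 (of A q)) (D.T₁ (a ⊗ₜ b))
  refine h.trans ?_
  rw [T₁_spec, T₁_spec, mul_assoc, tmulMultiplier_mul, map_mul, one_mul]

theorem lact_delta_T₄ (hA : IsNondegenerateIdempotent A) (a c b : A) :
    lact (D.Δ a) (D.T₄ (c ⊗ₜ b)) = D.T₄ (c ⊗ₜ (a * b)) := by
  apply (hA.tensor hA).of_injective
  rw [of_lact, T₄_spec, T₄_spec, map_mul, mul_assoc]

/-- `((r ⊗ s)Δ(a))(1 ⊗ q) = (r ⊗ s)(Δ(a)(1 ⊗ q))`. -/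
theorem lTensor_mulRight_ract (hA : IsNondegenerateIdempotent A) (a q : A) (x : A ⊗[ℂ] A) :
    (LinearMap.mulRight ℂ q).lTensor A (ract (D.Δ a) x) = x * D.T₁ (a ⊗ₜ q) := by
  apply (hA.tensor hA).of_injective
  have h := of_ract (tmulMultiplier 1 (of A q)) (ract (D.Δ a) x)
  refine h.trans ?_
  rw [of_ract, map_mul, T₁_spec, mul_assoc]

theorem T₂_mul (c a : A) (x : A ⊗[ℂ] A) :
    D.T₂ (c ⊗ₜ a) * x = (LinearMap.mulLeft ℂ c).rTensor A (lact (D.Δ a) x) := by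
  have := congrArg (fun m => lact m x) (D.T₂_spec c a)
  exact this

theorem T₁_mul (a b u v : A) :
    D.T₁ (a ⊗ₜ b) * (u ⊗ₜ v) = lact (D.Δ a) (u ⊗ₜ (b * v)) := by
  have := congrArg (fun m => lact m (u ⊗ₜ v)) (D.T₁_spec a b)
  exact this

end RegularCoproduct

end Coproducts

/-! ### Coassociativity and the canonical idempotent -/

section Coproducts

variable {A : Type*} [NonUnitalRing A] [Module ℂ A] [IsScalarTower ℂ A A] [SMulCommClass ℂ A A]
variable {B : Type*} [NonUnitalRing B] [Module ℂ B] [IsScalarTower ℂ B B] [SMulCommClass ℂ B B]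

theorem lact_rTensor_mulRight (hA : IsNondegenerateIdempotent A)
    (hB : IsNondegenerateIdempotent B) (m : MultiplierAlgebra (A ⊗[ℂ] B)) (u : A) (z : A ⊗[ℂ] B) :
    lact m ((LinearMap.mulRight ℂ u).rTensor B z) =
      (LinearMap.mulRight ℂ u).rTensor B (lact m z) := by
  apply (hA.tensor hB).of_injective
  have h := of_ract (tmulMultiplier (of A u) (1 : MultiplierAlgebra B)) (lact m z)
  have h' := of_ract (tmulMultiplier (of A u) (1 : MultiplierAlgebra B)) z
  rw [of_lact]
  refine (congrArg (m * ·) h').trans (Eq.trans ?_ h.symm)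
  rw [of_lact, mul_assoc]

theorem lact_lTensor_mulRight (hA : IsNondegenerateIdempotent A)
    (hB : IsNondegenerateIdempotent B) (m : MultiplierAlgebra (A ⊗[ℂ] B)) (u : B) (z : A ⊗[ℂ] B) :
    lact m ((LinearMap.mulRight ℂ u).lTensor A z) =
      (LinearMap.mulRight ℂ u).lTensor A (lact m z) := by
  apply (hA.tensor hB).of_injective
  have h := of_ract (tmulMultiplier (1 : MultiplierAlgebra A) (of B u)) (lact m z)
  have h' := of_ract (tmulMultiplier (1 : MultiplierAlgebra A) (of B u)) z
  rw [of_lact]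
  refine (congrArg (m * ·) h').trans (Eq.trans ?_ h.symm)
  rw [of_lact, mul_assoc]

theorem assoc_mulRight_tmul (u p q : A) (z : (A ⊗[ℂ] A) ⊗[ℂ] A) :
    TensorProduct.assoc ℂ A A A ((LinearMap.mulRight ℂ (u ⊗ₜ[ℂ] p)).rTensor A
        ((LinearMap.mulRight ℂ q).lTensor (A ⊗[ℂ] A) z)) =
      (LinearMap.mulRight ℂ (p ⊗ₜ[ℂ] q)).lTensor A
        ((LinearMap.mulRight ℂ u).rTensor (A ⊗[ℂ] A) (TensorProduct.assoc ℂ A A A z)) :=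
  LinearMap.congr_fun (f := (TensorProduct.assoc ℂ A A A).toLinearMap ∘ₗ
      (LinearMap.mulRight ℂ (u ⊗ₜ[ℂ] p)).rTensor A ∘ₗ
        (LinearMap.mulRight ℂ q).lTensor (A ⊗[ℂ] A))
    (g := (LinearMap.mulRight ℂ (p ⊗ₜ[ℂ] q)).lTensor A ∘ₗ
      (LinearMap.mulRight ℂ u).rTensor (A ⊗[ℂ] A) ∘ₗ (TensorProduct.assoc ℂ A A A).toLinearMap)
    (TensorProduct.ext_threefold fun _ _ _ => by simp) z

namespace RegularCoproduct

variable {D : RegularCoproduct A}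

/-- `(Δ ⊗ ι)(Δ(a)(1 ⊗ q))(u ⊗ p ⊗ 1) = (ι ⊗ Δ)(Δ(a)(u ⊗ 1))(1 ⊗ p ⊗ q)`. -/
theorem coassoc_deltaAct (hA : IsNondegenerateIdempotent A) (a u p q : A) :
    TensorProduct.assoc ℂ A A A ((D.deltaAct (u ⊗ₜ p)).rTensor A (D.T₁ (a ⊗ₜ q))) =
      (D.deltaAct (p ⊗ₜ q)).lTensor A (D.T₄ (u ⊗ₜ a)) := by
  suffices h : (TensorProduct.assoc ℂ A A A).toLinearMap ∘ₗ (D.deltaAct (u ⊗ₜ p)).rTensor A ∘ₗ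
      D.T₁ ∘ₗ TensorProduct.mk ℂ A A a =
      (LinearMap.lTensorHom A ∘ₗ D.deltaAct ∘ₗ TensorProduct.mk ℂ A A p).flip (D.T₄ (u ⊗ₜ a)) from
    LinearMap.congr_fun h q
  refine hA.linearMap_ext fun b q' => hA.rTensor_mulLeft_separates fun c => ?_
  change (LinearMap.mulLeft ℂ c).rTensor _ (TensorProduct.assoc ℂ A A A
      ((D.deltaAct (u ⊗ₜ p)).rTensor A (D.T₁ (a ⊗ₜ (b * q'))))) =
    (LinearMap.mulLeft ℂ c).rTensor _ ((D.deltaAct (p ⊗ₜ (b * q'))).lTensor A (D.T₄ (u ⊗ₜ a)))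
  have h1 : (LinearMap.mulLeft ℂ c).rTensor A ∘ₗ D.deltaAct (u ⊗ₜ p) =
      LinearMap.mulRight ℂ (u ⊗ₜ[ℂ] p) ∘ₗ D.T₂ ∘ₗ TensorProduct.mk ℂ A A c :=
    LinearMap.ext fun s => (D.T₂_mul c s _).symm
  have h2 : D.deltaAct (p ⊗ₜ (b * q')) =
      LinearMap.mulRight ℂ (p ⊗ₜ[ℂ] q') ∘ₗ D.T₁ ∘ₗ (TensorProduct.mk ℂ A A).flip b :=
    LinearMap.ext fun s => (D.T₁_mul s b p q').symm
  rw [rTensor_assoc, ← LinearMap.rTensor_comp_apply, h1, ← D.lTensor_mulRight_T₁ hA,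
    LinearMap.rTensor_comp_apply, rTensor_lTensor_comm, assoc_mulRight_tmul, D.coassoc a b c,
    rTensor_lTensor_comm, rTensor_lTensor_comm, ← D.rTensor_mulRight_T₂ hA, h2]
  simp only [LinearMap.lTensor_comp_apply]

namespace IsCanonicalIdempotent

variable {E : MultiplierAlgebra (A ⊗[ℂ] A)}

theorem lact_delta (hE : D.IsCanonicalIdempotent E) (a : A) (x : A ⊗[ℂ] A) :
    lact E (lact (D.Δ a) x) = lact (D.Δ a) x := by
  have : lact (D.Δ a) x ∈ LinearMap.range (lact E) :=
    hE.range_left ▸ Submodule.subset_span ⟨a, x, rfl⟩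
  obtain ⟨y, hy⟩ := this
  rw [← hy, ← lact_mul, hE.idem]

theorem delta_mul (hA : IsNondegenerateIdempotent A) (hE : D.IsCanonicalIdempotent E) (a : A) :
    D.Δ a * E = D.Δ a := by
  have h (x : A ⊗[ℂ] A) : ract E (ract (D.Δ a) x) = ract (D.Δ a) x := by
    have : ract (D.Δ a) x ∈ LinearMap.range (ract E) :=
      hE.range_right ▸ Submodule.subset_span ⟨a, x, rfl⟩
    obtain ⟨y, hy⟩ := this
    rw [← hy, ← ract_mul, hE.idem]
  refine (hA.tensor hA).lact_injective fun x =>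
    sub_eq_zero.1 ((hA.tensor hA).eq_zero_of_mul_left _ fun y => ?_)
  rw [mul_sub, ← ract_mul_eq, ← ract_mul_eq, ract_mul, h, sub_self]

theorem delta_lact (hA : IsNondegenerateIdempotent A) (hE : D.IsCanonicalIdempotent E) (a : A)
    (x : A ⊗[ℂ] A) : lact (D.Δ a) (lact E x) = lact (D.Δ a) x := by
  rw [← lact_mul, hE.delta_mul hA]

theorem lact_T₁ (hA : IsNondegenerateIdempotent A) (hE : D.IsCanonicalIdempotent E) (a b : A) :
    lact E (D.T₁ (a ⊗ₜ b)) = D.T₁ (a ⊗ₜ b) :=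
  hA.rTensor_mulRight_separates fun u => by
    rw [← lact_rTensor_mulRight hA hA, D.rTensor_mulRight_T₁ hA, hE.lact_delta]

theorem lact_T₄ (hA : IsNondegenerateIdempotent A) (hE : D.IsCanonicalIdempotent E) (a b : A) :
    lact E (D.T₄ (a ⊗ₜ b)) = D.T₄ (a ⊗ₜ b) :=
  hA.lTensor_mulRight_separates fun u => by
    rw [← lact_lTensor_mulRight hA hA, D.lTensor_mulRight_T₄ hA, hE.lact_delta]

theorem lact_induction (hE : D.IsCanonicalIdempotent E) {V : Type*} [AddCommGroup V] [Module ℂ V]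
    {f g : A ⊗[ℂ] A →ₗ[ℂ] V} (h : ∀ a x, f (lact (D.Δ a) x) = g (lact (D.Δ a) x))
    (x : A ⊗[ℂ] A) : f (lact E x) = g (lact E x) := by
  have hx : lact E x ∈ LinearMap.range (lact E) := ⟨x, rfl⟩
  rw [← hE.range_left] at hx
  refine LinearMap.eqOn_span ?_ hx
  rintro _ ⟨a, y, rfl⟩
  exact h a y

theorem ract_induction (hE : D.IsCanonicalIdempotent E) {V : Type*} [AddCommGroup V] [Module ℂ V]
    {f g : A ⊗[ℂ] A →ₗ[ℂ] V} (h : ∀ a x, f (ract (D.Δ a) x) = g (ract (D.Δ a) x))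
    (x : A ⊗[ℂ] A) : f (ract E x) = g (ract E x) := by
  have hx : ract E x ∈ LinearMap.range (ract E) := ⟨x, rfl⟩
  rw [← hE.range_right] at hx
  refine LinearMap.eqOn_span ?_ hx
  rintro _ ⟨a, y, rfl⟩
  exact h a y

end IsCanonicalIdempotent

end RegularCoproduct
end Coproducts

/-! ### The formula `(ι ⊗ Δ)(E) = E₁₂E₂₃` -/

section Coproducts

variable {A : Type*} [NonUnitalRing A] [Module ℂ A] [IsScalarTower ℂ A A] [SMulCommClass ℂ A A]

theorem assoc_lact_leg23 (E : MultiplierAlgebra (A ⊗[ℂ] A)) (z : (A ⊗[ℂ] A) ⊗[ℂ] A) :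
    TensorProduct.assoc ℂ A A A (lact (leg23 E) z) =
      (lact E).lTensor A (TensorProduct.assoc ℂ A A A z) :=
  (TensorProduct.assoc ℂ A A A).apply_symm_apply _

namespace RegularCoproduct

variable {D : RegularCoproduct A} {E : MultiplierAlgebra (A ⊗[ℂ] A)}

/-- The map `w ↦ (ι ⊗ Δ)(w)(1 ⊗ t)` for `t ∈ A ⊗ A`. -/
noncomputable def idTensorDelta (D : RegularCoproduct A) (t : A ⊗[ℂ] A) :
    A ⊗[ℂ] A →ₗ[ℂ] (A ⊗[ℂ] A) ⊗[ℂ] A :=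
  (TensorProduct.assoc ℂ A A A).symm.toLinearMap ∘ₗ (D.deltaAct t).lTensor A

theorem idTensorDelta_tmul (t : A ⊗[ℂ] A) (u a : A) :
    D.idTensorDelta t (u ⊗ₜ a) = (TensorProduct.assoc ℂ A A A).symm (u ⊗ₜ lact (D.Δ a) t) := rfl

theorem lact_deltaTensorId (x z : A ⊗[ℂ] A) (r : A) :
    lact (D.deltaTensorId x) (z ⊗ₜ r) =
      (LinearMap.mulRight ℂ r).lTensor (A ⊗[ℂ] A) ((D.deltaAct z).rTensor A x) :=
  LinearMap.congr_fun (f := actOn (z ⊗ₜ r) ∘ₗ D.deltaTensorId)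
    (g := (LinearMap.mulRight ℂ r).lTensor (A ⊗[ℂ] A) ∘ₗ (D.deltaAct z).rTensor A)
    (TensorProduct.ext' fun _ _ => rfl) x

theorem deltaAct_lact_delta (a b : A) (t : A ⊗[ℂ] A) :
    D.deltaAct (lact (D.Δ b) t) a = D.deltaAct t (a * b) := (D.lact_delta_mul a b t).symm

theorem idTensorDelta_delta (hA : IsNondegenerateIdempotent A) (a u b : A) (t : A ⊗[ℂ] A) :
    D.idTensorDelta t (lact (D.Δ a) (u ⊗ₜ b)) =
      D.idTensorDelta (lact (D.Δ b) t) (D.T₄ (u ⊗ₜ a)) := by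
  have h : D.deltaAct (lact (D.Δ b) t) = D.deltaAct t ∘ₗ LinearMap.mulRight ℂ b :=
    LinearMap.ext fun s => D.deltaAct_lact_delta s b t
  rw [← D.lTensor_mulRight_T₄ hA, idTensorDelta, idTensorDelta, h, LinearMap.lTensor_comp]
  rfl

theorem idTensorDelta_tmul_T₄ (hA : IsNondegenerateIdempotent A) (a u p q : A) :
    D.idTensorDelta (p ⊗ₜ q) (D.T₄ (u ⊗ₜ a)) =
      (D.deltaAct (u ⊗ₜ p)).rTensor A (D.T₁ (a ⊗ₜ q)) :=
  (LinearEquiv.symm_apply_eq _).2 (coassoc_deltaAct hA a u p q).symm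

/-- `(Δ ⊗ ι)(E)` acts on `(Δ ⊗ ι)(x)` as `(Δ ⊗ ι)(Ex)`. -/
theorem lact_extended_deltaAct (hA : IsNondegenerateIdempotent A)
    (hE' : D.IsWeaklyComultiplicative E) (t x : A ⊗[ℂ] A) :
    lact (leg12 E) (lact (leg23 E) ((D.deltaAct t).rTensor A x)) =
      (D.deltaAct t).rTensor A (lact E x) := by
  refine hA.lTensor_mulRight_separates fun r => ?_
  have h := congrArg (fun m => lact m (t ⊗ₜ r)) (hE'.extension.mul_left x)
  simp only [lact_mul, lact_deltaTensorId] at h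
  rw [← h, ← lact_lTensor_mulRight (hA.tensor hA) hA, ← lact_lTensor_mulRight (hA.tensor hA) hA]

theorem lact_leg23_idTensorDelta (hE : D.IsCanonicalIdempotent E) (t w : A ⊗[ℂ] A) :
    lact (leg23 E) (D.idTensorDelta t w) = D.idTensorDelta t w := by
  have h : lact E ∘ₗ D.deltaAct t = D.deltaAct t := LinearMap.ext fun a => hE.lact_delta a t
  apply (TensorProduct.assoc ℂ A A A).injective
  rw [assoc_lact_leg23]
  simp only [idTensorDelta, LinearMap.comp_apply, LinearEquiv.coe_coe,
    LinearEquiv.apply_symm_apply]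
  rw [← LinearMap.lTensor_comp_apply, h]

/-- On `E(A ⊗ A) = Δ(A)(A ⊗ A)`, coassociativity turns the values of `ι ⊗ Δ` into values of `Δ ⊗ ι`
on `Δ(a) = EΔ(a)`, on which `(Δ ⊗ ι)(E)` acts as the identity. -/
theorem lact_leg12_idTensorDelta_lact (hA : IsNondegenerateIdempotent A)
    (hE : D.IsCanonicalIdempotent E) (hE' : D.IsWeaklyComultiplicative E) (t w : A ⊗[ℂ] A) :
    lact (leg12 E) (D.idTensorDelta t (lact E w)) = D.idTensorDelta t (lact E w) := by
  refine hE.lact_induction (f := lact (leg12 E) ∘ₗ D.idTensorDelta t) (g := D.idTensorDelta t)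
    (fun a x => ?_) w
  refine LinearMap.congr_fun (f := lact (leg12 E) ∘ₗ D.idTensorDelta t ∘ₗ lact (D.Δ a))
    (g := D.idTensorDelta t ∘ₗ lact (D.Δ a)) (TensorProduct.ext' fun u b => ?_) x
  simp only [LinearMap.comp_apply]
  refine (congrArg (lact (leg12 E)) (lact_leg23_idTensorDelta hE t _).symm).trans ?_
  rw [idTensorDelta_delta hA]
  generalize lact (D.Δ b) t = s
  induction s with
  | zero => simp [idTensorDelta]
  | add s s' hs hs' =>
    simpa [idTensorDelta, LinearMap.lTensor_add] using congrArg₂ (· + ·) hs hs'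
  | tmul p q => rw [idTensorDelta_tmul_T₄ hA, lact_extended_deltaAct hA hE', hE.lact_T₁ hA]

/-- `(Δ ⊗ ι)((r ⊗ s)Δ(a))(ι ⊗ Δ)(w) = (Δ(r) ⊗ s)(ι ⊗ Δ)(Δ(a)w)`, by coassociativity. -/
theorem lact_deltaTensorId_idTensorDelta (hA : IsNondegenerateIdempotent A)
    (a r s : A) (t w : A ⊗[ℂ] A) :
    lact (D.deltaTensorId (ract (D.Δ a) (r ⊗ₜ s))) (D.idTensorDelta t w) =
      lact (tmulMultiplier (D.Δ r) (of A s)) (D.idTensorDelta t (lact (D.Δ a) w)) := by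
  refine LinearMap.congr_fun
    (f := lact (D.deltaTensorId (ract (D.Δ a) (r ⊗ₜ s))) ∘ₗ D.idTensorDelta t)
    (g := lact (tmulMultiplier (D.Δ r) (of A s)) ∘ₗ D.idTensorDelta t ∘ₗ lact (D.Δ a))
    (TensorProduct.ext' fun u b => ?_) w
  simp only [LinearMap.comp_apply]
  rw [idTensorDelta_delta hA, idTensorDelta_tmul]
  generalize lact (D.Δ b) t = z
  induction z with
  | zero => simp [idTensorDelta]
  | add z z' hz hz' =>
    simpa [idTensorDelta, LinearMap.lTensor_add, TensorProduct.tmul_add] using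
      congrArg₂ (· + ·) hz hz'
  | tmul p q =>
    rw [idTensorDelta_tmul_T₄ hA, TensorProduct.assoc_symm_tmul, lact_deltaTensorId,
      ← rTensor_lTensor_comm, D.lTensor_mulRight_ract hA]
    generalize D.T₁ (a ⊗ₜ q) = y
    refine LinearMap.congr_fun
      (f := (D.deltaAct (u ⊗ₜ p)).rTensor A ∘ₗ LinearMap.mulLeft ℂ (r ⊗ₜ[ℂ] s))
      (g := lact (tmulMultiplier (D.Δ r) (of A s)) ∘ₗ (D.deltaAct (u ⊗ₜ p)).rTensor A)
      (TensorProduct.ext' fun c d => ?_) y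
    simp

theorem lact_leg12_eq_zero (hA : IsNondegenerateIdempotent A) (hE : D.IsCanonicalIdempotent E)
    (z : (A ⊗[ℂ] A) ⊗[ℂ] A)
    (h : ∀ b s : A, lact (tmulMultiplier (D.Δ b) (of A s)) z = 0) : lact (leg12 E) z = 0 := by
  refine rTensor_separates (fun k : A ⊗[ℂ] A => LinearMap.mulLeft ℂ k)
    (fun a h => (hA.tensor hA).eq_zero_of_mul_left a h) _ fun k => ?_
  refine lTensor_separates (fun b : A => LinearMap.mulLeft ℂ b)
    (fun a h => hA.eq_zero_of_mul_left a h) _ fun s => ?_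
  have h1 : (LinearMap.mulLeft ℂ k).rTensor A (lact (leg12 E) z) =
      (LinearMap.mulLeft ℂ (ract E k)).rTensor A z := by
    have : LinearMap.mulLeft ℂ (ract E k) = LinearMap.mulLeft ℂ k ∘ₗ lact E :=
      LinearMap.ext fun y => ract_mul_eq E k y
    rw [this, LinearMap.rTensor_comp_apply]
    rfl
  rw [h1]
  refine hE.ract_induction (g := 0) (f := (LinearMap.mulLeft ℂ s).lTensor (A ⊗[ℂ] A) ∘ₗ
    (LinearMap.rTensorHom A ∘ₗ LinearMap.mul ℂ (A ⊗[ℂ] A)).flip z) (fun b x => ?_) k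
  have h2 : LinearMap.mulLeft ℂ (ract (D.Δ b) x) = LinearMap.mulLeft ℂ x ∘ₗ lact (D.Δ b) :=
    LinearMap.ext fun y => ract_mul_eq (D.Δ b) x y
  change (LinearMap.mulLeft ℂ s).lTensor (A ⊗[ℂ] A)
    ((LinearMap.mulLeft ℂ (ract (D.Δ b) x)).rTensor A z) = 0
  have h3 : (lact (D.Δ b)).rTensor A ((LinearMap.mulLeft ℂ s).lTensor (A ⊗[ℂ] A) z) =
      lact (tmulMultiplier (D.Δ b) (of A s)) z := by
    rw [← LinearMap.comp_apply, LinearMap.rTensor_comp_lTensor]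
    rfl
  rw [h2, LinearMap.rTensor_comp_apply, ← rTensor_lTensor_comm, ← rTensor_lTensor_comm, h3, h,
    map_zero]

/-- If `Ew = 0`, then `Δ(a)w = 0` for all `a`. By coassociativity `(ι ⊗ Δ)(w)` is then annihilated
by `(Δ ⊗ ι)(xE)` for all `x`, because `(A ⊗ A)E = (A ⊗ A)Δ(A)`. -/
theorem lact_leg12_idTensorDelta_of_eq_zero (hA : IsNondegenerateIdempotent A)
    (hE : D.IsCanonicalIdempotent E) (hE' : D.IsWeaklyComultiplicative E) (t w : A ⊗[ℂ] A)
    (hw : lact E w = 0) : lact (leg12 E) (D.idTensorDelta t w) = 0 := by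
  have h0 (a : A) : lact (D.Δ a) w = 0 := by rw [← hE.delta_lact hA, hw, map_zero]
  have h1 (x : A ⊗[ℂ] A) : lact (D.deltaTensorId x)
      (lact (leg12 E) (lact (leg23 E) (D.idTensorDelta t w))) = 0 := by
    change lact (D.deltaTensorId x * (leg12 E * leg23 E)) (D.idTensorDelta t w) = 0
    rw [hE'.extension.mul_right]
    refine hE.ract_induction (f := actOn (D.idTensorDelta t w) ∘ₗ D.deltaTensorId) (g := 0)
      (fun a y => ?_) x
    refine LinearMap.congr_fun
      (f := actOn (D.idTensorDelta t w) ∘ₗ D.deltaTensorId ∘ₗ ract (D.Δ a)) (g := 0)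
      (TensorProduct.ext' fun r s => ?_) y
    simp only [LinearMap.comp_apply, actOn_apply]
    rw [lact_deltaTensorId_idTensorDelta hA, h0, map_zero, map_zero]
    rfl
  have h2 := lact_leg12_eq_zero hA hE _ fun b s => h1 (b ⊗ₜ s)
  change lact (leg12 E * (leg12 E * leg23 E)) (D.idTensorDelta t w) = 0 at h2
  rwa [hE'.extension.unit_left, lact_mul, lact_leg23_idTensorDelta hE] at h2

/-- `(ι ⊗ Δ)(E) = E₁₂E₂₃`, in the form `(ι ⊗ Δ)(Ew) = E₁₂(ι ⊗ Δ)(w)`. -/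
theorem lact_leg12_idTensorDelta (hA : IsNondegenerateIdempotent A)
    (hE : D.IsCanonicalIdempotent E) (hE' : D.IsWeaklyComultiplicative E) (t w : A ⊗[ℂ] A) :
    lact (leg12 E) (D.idTensorDelta t w) = D.idTensorDelta t (lact E w) := by
  have h : lact E (w - lact E w) = 0 := by rw [map_sub, ← lact_mul, hE.idem, sub_self]
  have h1 := lact_leg12_idTensorDelta_of_eq_zero hA hE hE' t _ h
  rw [map_sub, map_sub, sub_eq_zero] at h1
  rw [h1, lact_leg12_idTensorDelta_lact hA hE hE']

end RegularCoproduct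
end Coproducts

/-! ### The coproduct on the base algebra `M(C)` -/

section Coproducts

variable {A : Type*} [NonUnitalRing A] [Module ℂ A] [IsScalarTower ℂ A A] [SMulCommClass ℂ A A]

theorem RegularCoproduct.IsFull.eq_of_lTensor_T₄ {D : RegularCoproduct A} (hD : D.IsFull)
    (hA : IsNondegenerateIdempotent A) {V : Type*} [AddCommGroup V] [Module ℂ V] {f g : A →ₗ[ℂ] V}
    (h : ∀ d a : A, f.lTensor A (D.T₄ (d ⊗ₜ a)) = g.lTensor A (D.T₄ (d ⊗ₜ a))) : f = g := by
  refine sub_eq_zero.1 (LinearMap.ker_eq_top.1 (hD.right _ fun c a => mem_range_lTensor_ker _ _ ?_))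
  refine hA.rTensor_mulRight_separates fun d => ?_
  rw [map_zero, rTensor_lTensor_comm, D.rTensor_mulRight_T₂ hA, ← rTensor_lTensor_comm,
    LinearMap.lTensor_sub, LinearMap.sub_apply, h, sub_self, map_zero]

theorem RegularCoproduct.IsFull.eq_of_lTensor_T₂ {D : RegularCoproduct A} (hD : D.IsFull)
    {V : Type*} [AddCommGroup V] [Module ℂ V] {f g : A →ₗ[ℂ] V}
    (h : ∀ d a : A, f.lTensor A (D.T₂ (d ⊗ₜ a)) = g.lTensor A (D.T₂ (d ⊗ₜ a))) : f = g := by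
  refine sub_eq_zero.1 (LinearMap.ker_eq_top.1 (hD.right _ fun c a => mem_range_lTensor_ker _ _ ?_))
  rw [LinearMap.lTensor_sub, LinearMap.sub_apply, h, sub_self]

theorem tensorSpan_eq_range (V W : Submodule ℂ (MultiplierAlgebra A)) :
    tensorSpan V W =
      LinearMap.range (TensorProduct.lift ((tmulBilin A A).domRestrict₁₂ V W)) := by
  apply le_antisymm
  · refine Submodule.span_le.2 ?_
    rintro _ ⟨x, hx, y, hy, rfl⟩
    exact ⟨(⟨x, hx⟩ : V) ⊗ₜ (⟨y, hy⟩ : W), rfl⟩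
  · rintro _ ⟨z, rfl⟩
    induction z with
    | zero => rw [map_zero]; exact Submodule.zero_mem _
    | add z z' hz hz' => rw [map_add]; exact Submodule.add_mem _ hz hz'
    | tmul x y => exact Submodule.subset_span ⟨x, x.2, y, y.2, rfl⟩

/-- The right leg of `E` is all of `C`: a linear condition `T y = 0` on multipliers holds on `C` as
soon as `(ι ⊗ T)(E(x ⊗ 1)) = 0` for all `x ∈ B`. The maps `Θ u` provide the values of
`(ι ⊗ T)(·)(u ⊗ 1)` on multipliers of `A ⊗ A`. -/
theorem IsRegularSeparabilityIdempotent.eq_zero_on_right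
    {B C : NonUnitalSubalgebra ℂ (MultiplierAlgebra A)} {E : MultiplierAlgebra (A ⊗[ℂ] A)}
    (hBC : IsRegularSeparabilityIdempotent B C E) (hA : IsNondegenerateIdempotent A)
    {V : Type*} [AddCommGroup V] [Module ℂ V] (T : MultiplierAlgebra A →ₗ[ℂ] V)
    (Θ : A → MultiplierAlgebra (A ⊗[ℂ] A) →ₗ[ℂ] A ⊗[ℂ] V)
    (hT : ∀ u, ∀ x ∈ B, ∀ y ∈ C, Θ u (tmulMultiplier x y) = lact x u ⊗ₜ T y)
    (hE : ∀ u, ∀ x ∈ B, Θ u (E * tmulMultiplier x 1) = 0) : ∀ y ∈ C, T y = 0 := by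
  have key : C.toSubmodule ⊓ LinearMap.ker T = C.toSubmodule := by
    refine hBC.full_right _ inf_le_left fun x hx => ?_
    have hx' := hBC.cover₄ x hx
    rw [tensorSpan_eq_range] at hx'
    obtain ⟨β, hβ⟩ := hx'
    let T' : C.toSubmodule →ₗ[ℂ] V := T.domRestrict C.toSubmodule
    have h0 : T'.lTensor B.toSubmodule β = 0 := by
      refine rTensor_separates
        (fun u : A => (actOn u).domRestrict B.toSubmodule) (fun y hy => ?_) _ fun u => ?_
      · exact Subtype.ext (hA.lact_injective fun a => hy a)
      · have h := hE u x hx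
        rw [← hβ] at h
        refine Eq.trans ?_ h
        refine LinearMap.congr_fun
          (f := ((actOn u).domRestrict B.toSubmodule).rTensor V ∘ₗ T'.lTensor B.toSubmodule)
          (g := Θ u ∘ₗ
            TensorProduct.lift ((tmulBilin A A).domRestrict₁₂ B.toSubmodule C.toSubmodule))
          (TensorProduct.ext' fun y z => ?_) β
        exact (hT u y y.2 z z.2).symm
    obtain ⟨γ, rfl⟩ := mem_range_lTensor_ker T' β h0
    rw [← hβ]
    clear hβ h0
    induction γ with
    | zero => rw [map_zero, map_zero]; exact Submodule.zero_mem _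
    | add z z' hz hz' => rw [map_add, map_add]; exact Submodule.add_mem _ hz hz'
    | tmul y z => exact Submodule.subset_span ⟨y, y.2, z, ⟨z.1.2, z.2⟩, rfl⟩
  intro y hy
  have : y ∈ C.toSubmodule ⊓ LinearMap.ker T := key.symm ▸ (show y ∈ C.toSubmodule from hy)
  exact this.2

theorem assoc_leg12_tmul (x y : MultiplierAlgebra A) (u : A) (t : A ⊗[ℂ] A) :
    TensorProduct.assoc ℂ A A A (lact (leg12 (tmulMultiplier x y))
      ((TensorProduct.assoc ℂ A A A).symm (u ⊗ₜ t))) = lact x u ⊗ₜ lact (tmulMultiplier y 1) t := by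
  induction t with
  | zero => simp
  | add t t' ht ht' => simp only [TensorProduct.tmul_add, map_add, ht, ht']
  | tmul p q => rfl

theorem leg12_tmul_one (x : MultiplierAlgebra A) (u : A) (t : A ⊗[ℂ] A) :
    lact (leg12 (tmulMultiplier x 1)) ((TensorProduct.assoc ℂ A A A).symm (u ⊗ₜ t)) =
      (TensorProduct.assoc ℂ A A A).symm (lact x u ⊗ₜ t) := by
  apply (TensorProduct.assoc ℂ A A A).injective
  rw [assoc_leg12_tmul, LinearEquiv.apply_symm_apply]
  exact congrArg _ (LinearMap.congr_fun TensorProduct.map_id t)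

theorem leg23_assoc_symm (τ : MultiplierAlgebra (A ⊗[ℂ] A)) (u : A) (t : A ⊗[ℂ] A) :
    lact (leg23 τ) ((TensorProduct.assoc ℂ A A A).symm (u ⊗ₜ t)) =
      (TensorProduct.assoc ℂ A A A).symm (u ⊗ₜ lact τ t) := by
  apply (TensorProduct.assoc ℂ A A A).injective
  rw [assoc_lact_leg23, LinearEquiv.apply_symm_apply, LinearEquiv.apply_symm_apply,
    LinearMap.lTensor_tmul]

/-- The map `τ ↦ τ₁₂z` from `M(A ⊗ A)` to `A ⊗ (A ⊗ A)`. -/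
noncomputable def leg12Act (z : A ⊗[ℂ] (A ⊗[ℂ] A)) :
    MultiplierAlgebra (A ⊗[ℂ] A) →ₗ[ℂ] A ⊗[ℂ] (A ⊗[ℂ] A) where
  toFun τ := TensorProduct.assoc ℂ A A A (lact (leg12 τ) ((TensorProduct.assoc ℂ A A A).symm z))
  map_add' τ τ' := by
    rw [← map_add]
    exact congrArg _ (LinearMap.congr_fun (LinearMap.rTensor_add A (lact τ) (lact τ')) _)
  map_smul' c τ := by
    rw [RingHom.id_apply, ← map_smul]
    exact congrArg _ (LinearMap.congr_fun (LinearMap.rTensor_smul A c (lact τ)) _)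

theorem leg12_mul (τ τ' : MultiplierAlgebra (A ⊗[ℂ] A)) :
    leg12 (τ * τ') = leg12 τ * leg12 τ' := by
  rw [leg12, leg12, leg12, tmulMultiplier_mul, one_mul]

section

variable {D : RegularCoproduct A} {E : MultiplierAlgebra (A ⊗[ℂ] A)}
  {B C : NonUnitalSubalgebra ℂ (MultiplierAlgebra A)}

/-- `Δ(ya) = (y ⊗ 1)Δ(a)` for `y ∈ C`. -/
theorem IsRegularSeparabilityIdempotent.delta_lact (hA : IsNondegenerateIdempotent A)
    (hE : D.IsCanonicalIdempotent E) (hE' : D.IsWeaklyComultiplicative E)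
    (hBC : IsRegularSeparabilityIdempotent B C E) {y : MultiplierAlgebra A} (hy : y ∈ C)
    (a : A) (t : A ⊗[ℂ] A) :
    lact (D.Δ (lact y a)) t = lact (tmulMultiplier y 1) (lact (D.Δ a) t) := by
  let T : MultiplierAlgebra A →ₗ[ℂ] A ⊗[ℂ] A := D.deltaAct t ∘ₗ actOn a -
    actOn (lact (D.Δ a) t) ∘ₗ (tmulBilin A A).flip 1
  let Θ (u : A) : MultiplierAlgebra (A ⊗[ℂ] A) →ₗ[ℂ] A ⊗[ℂ] (A ⊗[ℂ] A) :=
    (D.deltaAct t).lTensor A ∘ₗ actOn (u ⊗ₜ a) - leg12Act (u ⊗ₜ lact (D.Δ a) t)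
  refine sub_eq_zero.1 (hBC.eq_zero_on_right hA T Θ (fun u x _ y _ => ?_) (fun u x _ => ?_) y hy)
  · refine Eq.trans ?_ (TensorProduct.tmul_sub _ _ _).symm
    exact congrArg₂ (· - ·) rfl (assoc_leg12_tmul x y u _)
  · refine sub_eq_zero.2 ?_
    have h := congrArg (TensorProduct.assoc ℂ A A A)
      (D.lact_leg12_idTensorDelta hA hE hE' t (lact x u ⊗ₜ a))
    change _ = TensorProduct.assoc ℂ A A A (lact (leg12 (E * tmulMultiplier x 1)) _)
    rw [leg12_mul, lact_mul, leg12_tmul_one]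
    refine Eq.trans ?_ h.symm
    exact ((TensorProduct.assoc ℂ A A A).apply_symm_apply _).symm

/-- `y ⊗ 1` commutes with `E` for `y ∈ C`. -/
theorem IsRegularSeparabilityIdempotent.commute (hA : IsNondegenerateIdempotent A)
    (hE' : D.IsWeaklyComultiplicative E)
    (hBC : IsRegularSeparabilityIdempotent B C E) {y : MultiplierAlgebra A} (hy : y ∈ C)
    (t : A ⊗[ℂ] A) :
    lact E (lact (tmulMultiplier y 1) t) = lact (tmulMultiplier y 1) (lact E t) := by
  let T : MultiplierAlgebra A →ₗ[ℂ] A ⊗[ℂ] A := lact E ∘ₗ actOn t ∘ₗ (tmulBilin A A).flip 1 -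
    actOn (lact E t) ∘ₗ (tmulBilin A A).flip 1
  let Θ (u : A) : MultiplierAlgebra (A ⊗[ℂ] A) →ₗ[ℂ] A ⊗[ℂ] (A ⊗[ℂ] A) :=
    (lact E).lTensor A ∘ₗ leg12Act (u ⊗ₜ t) - leg12Act (u ⊗ₜ lact E t)
  refine sub_eq_zero.1 (hBC.eq_zero_on_right hA T Θ (fun u x _ y _ => ?_) (fun u x _ => ?_) y hy)
  · refine Eq.trans ?_ (TensorProduct.tmul_sub _ _ _).symm
    exact congrArg₂ (· - ·) (congrArg ((lact E).lTensor A) (assoc_leg12_tmul x y u t))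
      (assoc_leg12_tmul x y u _)
  · refine sub_eq_zero.2 ?_
    change (lact E).lTensor A
        (TensorProduct.assoc ℂ A A A (lact (leg12 (E * tmulMultiplier x 1)) _)) =
      TensorProduct.assoc ℂ A A A (lact (leg12 (E * tmulMultiplier x 1)) _)
    rw [← assoc_lact_leg23, leg12_mul, lact_mul, lact_mul, leg12_tmul_one, leg12_tmul_one,
      ← lact_mul, ← hE'.comm, lact_mul, leg23_assoc_symm]

/-- The extension of `IsRegularSeparabilityIdempotent.delta_lact` from `C` to `M(C)`. -/
theorem IsRegularSeparabilityIdempotent.delta_lact_of_mem_multipliersOf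
    (hA : IsNondegenerateIdempotent A)
    (hE : D.IsCanonicalIdempotent E) (hE' : D.IsWeaklyComultiplicative E)
    (hC : SitsNondegenerately C)
    (hBC : IsRegularSeparabilityIdempotent B C E) {y : MultiplierAlgebra A}
    (hy : y ∈ multipliersOf C) (a : A) (t : A ⊗[ℂ] A) :
    lact (D.Δ (lact y a)) t = lact (tmulMultiplier y 1) (lact (D.Δ a) t) := by
  refine LinearMap.congr_fun (f := D.deltaAct t ∘ₗ lact y)
    (g := lact (tmulMultiplier y 1) ∘ₗ D.deltaAct t) (LinearMap.ext_on hC.left ?_) a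
  rintro _ ⟨x, hx, a, rfl⟩
  change lact (D.Δ (lact (y * x) a)) t = lact (tmulMultiplier y 1) (lact (D.Δ (lact x a)) t)
  rw [hBC.delta_lact hA hE hE' (hy x hx).1, hBC.delta_lact hA hE hE' hx,
    ← lact_mul (tmulMultiplier y 1), tmulMultiplier_mul, one_mul]

theorem IsRegularSeparabilityIdempotent.commute_of_mem_multipliersOf
    (hA : IsNondegenerateIdempotent A) (hE' : D.IsWeaklyComultiplicative E)
    (hC : SitsNondegenerately C)
    (hBC : IsRegularSeparabilityIdempotent B C E) {y : MultiplierAlgebra A}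
    (hy : y ∈ multipliersOf C) (t : A ⊗[ℂ] A) :
    lact E (lact (tmulMultiplier y 1) t) = lact (tmulMultiplier y 1) (lact E t) := by
  refine LinearMap.congr_fun (f := lact E ∘ₗ lact (tmulMultiplier y 1))
    (g := lact (tmulMultiplier y 1) ∘ₗ lact E) (TensorProduct.ext ?_) t
  refine LinearMap.ext_on hC.left ?_
  rintro _ ⟨x, hx, a, rfl⟩
  ext b
  change lact E (lact (tmulMultiplier (y * x) 1) (a ⊗ₜ b)) =
    lact (tmulMultiplier y 1) (lact E (lact (tmulMultiplier x 1) (a ⊗ₜ b)))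
  rw [hBC.commute hA hE' (hy x hx).1, hBC.commute hA hE' hx, ← lact_mul (tmulMultiplier y 1),
    tmulMultiplier_mul, one_mul]

end
end Coproducts

/-! ### Left integrals and the coproduct -/

section Coproducts

variable {A : Type*} [NonUnitalRing A] [Module ℂ A] [IsScalarTower ℂ A A] [SMulCommClass ℂ A A]

/-- `ι ⊗ ι ⊗ φ : A ⊗ A ⊗ A → A ⊗ A`. -/
noncomputable def sliceThird (φ : A →ₗ[ℂ] ℂ) : (A ⊗[ℂ] A) ⊗[ℂ] A →ₗ[ℂ] A ⊗[ℂ] A :=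
  (TensorProduct.rid ℂ (A ⊗[ℂ] A)).toLinearMap ∘ₗ φ.lTensor (A ⊗[ℂ] A)

@[simp] theorem sliceRight_tmul (φ : A →ₗ[ℂ] ℂ) (a b : A) :
    sliceRight φ (a ⊗ₜ b) = φ b • a := by simp [sliceRight]

@[simp] theorem sliceThird_tmul (φ : A →ₗ[ℂ] ℂ) (t : A ⊗[ℂ] A) (b : A) :
    sliceThird φ (t ⊗ₜ b) = φ b • t := by simp [sliceThird]

theorem sliceThird_rTensor (φ : A →ₗ[ℂ] ℂ) (f : A →ₗ[ℂ] A ⊗[ℂ] A) (w : A ⊗[ℂ] A) :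
    sliceThird φ (f.rTensor A w) = f (sliceRight φ w) :=
  LinearMap.congr_fun (f := sliceThird φ ∘ₗ f.rTensor A) (g := f ∘ₗ sliceRight φ)
    (TensorProduct.ext' fun a b => by simp) w

theorem sliceThird_rTensor_tensor (φ : A →ₗ[ℂ] ℂ) (f : A ⊗[ℂ] A →ₗ[ℂ] A ⊗[ℂ] A)
    (w : (A ⊗[ℂ] A) ⊗[ℂ] A) : sliceThird φ (f.rTensor A w) = f (sliceThird φ w) :=
  LinearMap.congr_fun (f := sliceThird φ ∘ₗ f.rTensor A) (g := f ∘ₗ sliceThird φ)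
    (TensorProduct.ext' fun a b => by simp) w

theorem sliceThird_assoc_symm (φ : A →ₗ[ℂ] ℂ) (w : A ⊗[ℂ] (A ⊗[ℂ] A)) :
    sliceThird φ ((TensorProduct.assoc ℂ A A A).symm w) = (sliceRight φ).lTensor A w :=
  LinearMap.congr_fun (f := sliceThird φ ∘ₗ (TensorProduct.assoc ℂ A A A).symm.toLinearMap)
    (g := (sliceRight φ).lTensor A) (TensorProduct.ext_threefold' fun a b c => by simp) w

section

variable {D : RegularCoproduct A} {E : MultiplierAlgebra (A ⊗[ℂ] A)}
  {B C : NonUnitalSubalgebra ℂ (MultiplierAlgebra A)}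

/-- The map `d ⊗ c ↦ (ι ⊗ Δ)(Δ(v))(d ⊗ c ⊗ 1)`. -/
noncomputable def RegularCoproduct.deltaTwice (D : RegularCoproduct A) (v : A) :
    A ⊗[ℂ] A →ₗ[ℂ] (A ⊗[ℂ] A) ⊗[ℂ] A :=
  (TensorProduct.assoc ℂ A A A).symm.toLinearMap ∘ₗ TensorProduct.lift
    ((LinearMap.lTensorHom A ∘ₗ (TensorProduct.mk ℂ A A).compr₂ D.T₄).flip ∘ₗ
      (D.T₄ ∘ₗ (TensorProduct.mk ℂ A A).flip v))

theorem RegularCoproduct.deltaTwice_tmul (v d c : A) :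
    D.deltaTwice v (d ⊗ₜ c) = (TensorProduct.assoc ℂ A A A).symm
      ((D.T₄ ∘ₗ TensorProduct.mk ℂ A A c).lTensor A (D.T₄ (d ⊗ₜ v))) := rfl

theorem RegularCoproduct.lTensor_mulRight_deltaTwice (hA : IsNondegenerateIdempotent A) (v q : A)
    (x : A ⊗[ℂ] A) :
    (LinearMap.mulRight ℂ q).lTensor (A ⊗[ℂ] A) (D.deltaTwice v x) =
      (D.deltaAct x).rTensor A (D.T₁ (v ⊗ₜ q)) := by
  refine LinearMap.congr_fun
    (f := (LinearMap.mulRight ℂ q).lTensor (A ⊗[ℂ] A) ∘ₗ D.deltaTwice v)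
    (g := (LinearMap.rTensorHom A ∘ₗ D.deltaAct).flip (D.T₁ (v ⊗ₜ q)))
    (TensorProduct.ext' fun d c => ?_) x
  change (LinearMap.mulRight ℂ q).lTensor (A ⊗[ℂ] A) (D.deltaTwice v (d ⊗ₜ c)) =
    (D.deltaAct (d ⊗ₜ c)).rTensor A (D.T₁ (v ⊗ₜ q))
  have h : (LinearMap.mulRight ℂ q).lTensor A ∘ₗ D.T₄ ∘ₗ TensorProduct.mk ℂ A A c =
      D.deltaAct (c ⊗ₜ q) := LinearMap.ext fun s => D.lTensor_mulRight_T₄ hA c s q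
  rw [← D.idTensorDelta_tmul_T₄ hA, D.deltaTwice_tmul, assoc_symm_lTensor_lTensor,
    ← LinearMap.lTensor_comp_apply, h]
  rfl

theorem RegularCoproduct.deltaTwice_lact (hA : IsNondegenerateIdempotent A)
    (hE : D.IsCanonicalIdempotent E) (v : A) (x : A ⊗[ℂ] A) :
    D.deltaTwice v (lact E x) = D.deltaTwice v x := by
  refine hA.lTensor_mulRight_separates fun q => ?_
  have h : D.deltaAct (lact E x) = D.deltaAct x := LinearMap.ext fun a => hE.delta_lact hA a x
  rw [D.lTensor_mulRight_deltaTwice hA, D.lTensor_mulRight_deltaTwice hA, h]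

theorem RegularCoproduct.deltaTwice_delta (hA : IsNondegenerateIdempotent A) (v a : A)
    (t : A ⊗[ℂ] A) :
    D.deltaTwice v (lact (D.Δ a) t) = (D.deltaAct t).rTensor A (D.T₄ (a ⊗ₜ v)) := by
  refine hA.lTensor_mulRight_separates fun q => ?_
  have h : D.deltaAct (lact (D.Δ a) t) = D.deltaAct t ∘ₗ LinearMap.mulRight ℂ a :=
    LinearMap.ext fun s => D.deltaAct_lact_delta s a t
  rw [D.lTensor_mulRight_deltaTwice hA, ← rTensor_lTensor_comm, D.lTensor_mulRight_T₄ hA, h,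
    LinearMap.rTensor_comp_apply, D.rTensor_mulRight_T₁ hA]

/-- With `y(v) = (ι ⊗ φ)Δ(v)`, this is `(ι ⊗ y)Δ(v) = Δ(y(v)) = E(y(v) ⊗ 1)`, multiplied by
`d ⊗ c` from the right. -/
theorem RegularCoproduct.IsLeftIntegral.lTensor_T₄ {φ : A →ₗ[ℂ] ℂ} (hφ : D.IsLeftIntegral C φ)
    (hA : IsNondegenerateIdempotent A)
    (hE : D.IsCanonicalIdempotent E) (hE' : D.IsWeaklyComultiplicative E)
    (hC : SitsNondegenerately C) (hBC : IsRegularSeparabilityIdempotent B C E) (d c v : A) :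
    (sliceRight φ ∘ₗ D.T₄ ∘ₗ TensorProduct.mk ℂ A A c).lTensor A (D.T₄ (d ⊗ₜ v)) =
      lact E (sliceRight φ (D.T₄ (d ⊗ₜ v)) ⊗ₜ c) := by
  obtain ⟨y, hy, hyl, -⟩ := hφ.2 v
  have h1 (x : A ⊗[ℂ] A) : sliceThird φ (D.deltaTwice v (lact E x)) =
      lact (tmulMultiplier y 1) (lact E x) := by
    refine hE.lact_induction (f := sliceThird φ ∘ₗ D.deltaTwice v)
      (g := lact (tmulMultiplier y 1)) (fun a t => ?_) x
    rw [LinearMap.comp_apply, D.deltaTwice_delta hA, sliceThird_rTensor, ← hyl, D.deltaAct_apply,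
      hBC.delta_lact_of_mem_multipliersOf hA hE hE' hC hy]
  have h2 := h1 (d ⊗ₜ c)
  rw [D.deltaTwice_lact hA hE, D.deltaTwice_tmul, sliceThird_assoc_symm,
    ← LinearMap.lTensor_comp_apply, ← hBC.commute_of_mem_multipliersOf hA hE' hC hy] at h2
  rw [← hyl]
  exact h2

/-! ### The flipped separability idempotent -/

/-- `E(u ⊗ c) = 0` for all `u` forces `c = 0`. -/
theorem RegularCoproduct.IsCanonicalIdempotent.eq_zero_of_lact_tmul
    (hA : IsNondegenerateIdempotent A) (hD : D.IsFull) (hE : D.IsCanonicalIdempotent E) (c : A)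
    (h : ∀ u : A, lact E (u ⊗ₜ c) = 0) : c = 0 := by
  have h1 : LinearMap.mulRight ℂ c = 0 := by
    refine hD.eq_of_lTensor_T₄ hA fun d a => ?_
    rw [D.lTensor_mulRight_T₄ hA, ← hE.delta_lact hA, h, map_zero, LinearMap.lTensor_zero,
      LinearMap.zero_apply]
  exact hA.eq_zero_of_mul_left c fun b => LinearMap.congr_fun h1 b

theorem rTensor_lact_mk (c : A) (z : A ⊗[ℂ] A) :
    (lact E ∘ₗ TensorProduct.mk ℂ A A c).rTensor A z =
      lact (leg12 E) ((TensorProduct.assoc ℂ A A A).symm (c ⊗ₜ z)) :=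
  LinearMap.congr_fun (f := (lact E ∘ₗ TensorProduct.mk ℂ A A c).rTensor A)
    (g := lact (leg12 E) ∘ₗ (TensorProduct.assoc ℂ A A A).symm.toLinearMap ∘ₗ
      TensorProduct.mk ℂ A (A ⊗[ℂ] A) c)
    (TensorProduct.ext' fun _ _ => rfl) z

/-- Let `F = (σ ⊗ ι)E`, where `σ : B → C` is given by `E(x ⊗ 1) = E(1 ⊗ σ(x))`. The map
`v ↦ F(c ⊗ v)` is characterised by `E₁₂F₂₃ = E₁₂E₁₃`. -/
theorem IsRegularSeparabilityIdempotent.exists_flip (hA : IsNondegenerateIdempotent A)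
    (hD : D.IsFull) (hE : D.IsCanonicalIdempotent E) (hC : SitsNondegenerately C)
    (hBC : IsRegularSeparabilityIdempotent B C E) (c : A) :
    ∃ Φ : A →ₗ[ℂ] A ⊗[ℂ] A, ∀ u v : A,
      (lact E ∘ₗ TensorProduct.mk ℂ A A u).rTensor A (Φ v) =
        (lact E ∘ₗ (TensorProduct.mk ℂ A A).flip c).rTensor A (lact E (u ⊗ₜ v)) := by
  -- `K z` is `u ↦ E₁₂(u ⊗ z)` and `H v` is `u ↦ E₁₂E₁₃(u ⊗ c ⊗ v)`; as `K` is injective with a range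
  -- containing that of `H`, one may put `Φ = K⁻¹H`.
  let K : A ⊗[ℂ] A →ₗ[ℂ] A → (A ⊗[ℂ] A) ⊗[ℂ] A :=
    LinearMap.pi fun u => (lact E ∘ₗ TensorProduct.mk ℂ A A u).rTensor A
  let H : A →ₗ[ℂ] A → (A ⊗[ℂ] A) ⊗[ℂ] A := LinearMap.pi fun u =>
    (lact E ∘ₗ (TensorProduct.mk ℂ A A).flip c).rTensor A ∘ₗ lact E ∘ₗ TensorProduct.mk ℂ A A u
  have hK : LinearMap.ker K = ⊥ := by
    refine LinearMap.ker_eq_bot'.2 fun z hz => ?_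
    exact rTensor_separates (fun u => lact E ∘ₗ TensorProduct.mk ℂ A A u)
      (fun v hv => hE.eq_zero_of_lact_tmul hA hD v hv) z fun u => congrFun hz u
  have hrange : (LinearMap.range K).comap H = ⊤ := by
    rw [eq_top_iff, ← hC.left, Submodule.span_le]
    rintro _ ⟨y, hy, v, rfl⟩
    -- As `E(1 ⊗ y) ∈ B ⊗ C`, the `E₁₃` in `H (y v)` can be replaced by elements `x ⊗ y' ∈ B ⊗ C`,
    -- and `x` moves through `E₁₂` to the second leg.
    have key : ∀ τ ∈ tensorSpan B.toSubmodule C.toSubmodule, ∃ z : A ⊗[ℂ] A, ∀ u : A, K z u =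
        (lact E ∘ₗ (TensorProduct.mk ℂ A A).flip c).rTensor A (lact τ (u ⊗ₜ v)) := by
      intro τ hτ
      induction hτ using Submodule.span_induction with
      | mem τ hτ =>
        obtain ⟨x, hx, y, hy, rfl⟩ := hτ
        obtain ⟨s, -, hs⟩ :=
          (Set.ext_iff.1 hBC.regular_left (E * tmulMultiplier x 1)).1 ⟨x, hx, rfl⟩
        refine ⟨lact s c ⊗ₜ lact y v, fun u => ?_⟩
        have := congrArg (fun m => lact m (u ⊗ₜ c) ⊗ₜ[ℂ] lact y v) hs
        exact this.symm
      | zero => exact ⟨0, fun u => by rw [map_zero]; exact (map_zero _).symm⟩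
      | add τ τ' _ _ h h' =>
        obtain ⟨z, hz⟩ := h
        obtain ⟨z', hz'⟩ := h'
        refine ⟨z + z', fun u => ?_⟩
        rw [map_add, Pi.add_apply, hz, hz', ← map_add]
        rfl
      | smul k τ _ h =>
        obtain ⟨z, hz⟩ := h
        refine ⟨k • z, fun u => ?_⟩
        rw [map_smul, Pi.smul_apply, hz, ← map_smul]
        rfl
    obtain ⟨z, hz⟩ := key _ (hBC.cover₁ y hy)
    exact ⟨z, funext hz⟩
  obtain ⟨L, hL⟩ := LinearMap.exists_leftInverse_of_injective K hK
  refine ⟨L ∘ₗ H, fun u v => ?_⟩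
  obtain ⟨z, hz⟩ : v ∈ (LinearMap.range K).comap H := hrange ▸ trivial
  have : K (L (H v)) = H v := by
    rw [← hz, ← LinearMap.comp_apply L K, hL, LinearMap.id_apply]
  exact congrFun this u

/-- `E₁₂E₁₃ = F₂₃E₁₃`, with `F` as in `IsRegularSeparabilityIdempotent.exists_flip`. -/
theorem IsRegularSeparabilityIdempotent.exists_flip_lTensor (hA : IsNondegenerateIdempotent A)
    (hD : D.IsFull) (hE : D.IsCanonicalIdempotent E) (hB : SitsNondegenerately B)
    (hC : SitsNondegenerately C) (hBC : IsRegularSeparabilityIdempotent B C E) (c : A) :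
    ∃ Φ : A →ₗ[ℂ] A ⊗[ℂ] A, ∀ w : A ⊗[ℂ] A,
      (lact E ∘ₗ (TensorProduct.mk ℂ A A).flip c).rTensor A (lact E w) =
        (TensorProduct.assoc ℂ A A A).symm (Φ.lTensor A (lact E w)) := by
  obtain ⟨Φ, hΦ⟩ := hBC.exists_flip hA hD hE hC c
  -- `Φ(yv) = (y ⊗ 1)Φ(v)`: write `E(1 ⊗ y) = E(x ⊗ 1)` and move `x` through `E₁₂`.
  have hmul (y : MultiplierAlgebra A) (hy : y ∈ C) (v : A) :
      Φ (lact y v) = lact (tmulMultiplier y 1) (Φ v) := by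
    refine sub_eq_zero.1 (rTensor_separates (fun u => lact E ∘ₗ TensorProduct.mk ℂ A A u)
      (fun v hv => hE.eq_zero_of_lact_tmul hA hD v hv) _ fun u => ?_)
    obtain ⟨x, -, hx⟩ := (Set.ext_iff.1 hBC.regular_left (E * tmulMultiplier 1 y)).2 ⟨y, hy, rfl⟩
    have h1 : (lact E ∘ₗ TensorProduct.mk ℂ A A u) ∘ₗ lact y =
        lact E ∘ₗ TensorProduct.mk ℂ A A (lact x u) :=
      LinearMap.ext fun k => congrArg (fun m => lact m (u ⊗ₜ k)) hx
    have h2 : lact E (u ⊗ₜ lact y v) = lact E (lact x u ⊗ₜ v) :=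
      congrArg (fun m => lact m (u ⊗ₜ v)) hx
    have h3 : lact (tmulMultiplier y 1) (Φ v) = (lact y).rTensor A (Φ v) := rfl
    rw [map_sub, hΦ, h2, ← hΦ, h3, ← LinearMap.rTensor_comp_apply, h1, sub_self]
  refine ⟨Φ, fun w => ?_⟩
  refine LinearMap.congr_fun
    (f := (lact E ∘ₗ (TensorProduct.mk ℂ A A).flip c).rTensor A ∘ₗ lact E)
    (g := (TensorProduct.assoc ℂ A A A).symm.toLinearMap ∘ₗ Φ.lTensor A ∘ₗ lact E)
    (TensorProduct.ext (LinearMap.ext_on hB.left ?_)) w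
  rintro _ ⟨x, hx, u, rfl⟩
  ext v
  change (lact E ∘ₗ (TensorProduct.mk ℂ A A).flip c).rTensor A (lact E (lact x u ⊗ₜ v)) =
    (TensorProduct.assoc ℂ A A A).symm (Φ.lTensor A (lact (E * tmulMultiplier x 1) (u ⊗ₜ v)))
  -- By `hmul`, `F₂₃τ₁₃ = τ₁₂F₂₃` for `τ ∈ B ⊗ C`; this is used for `τ = E(x ⊗ 1)`.
  have key : Set.EqOn (Φ.lTensor A ∘ₗ actOn (u ⊗ₜ v)) (leg12Act (u ⊗ₜ Φ v))
      (tensorSpan B.toSubmodule C.toSubmodule) := by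
    refine LinearMap.eqOn_span ?_
    rintro _ ⟨y, -, z, hz, rfl⟩
    exact (congrArg (lact y u ⊗ₜ[ℂ] ·) (hmul z hz v)).trans (assoc_leg12_tmul y z u (Φ v)).symm
  have h := key (hBC.cover₄ x hx)
  refine Eq.trans ?_ (congrArg (TensorProduct.assoc ℂ A A A).symm h).symm
  change _ = (TensorProduct.assoc ℂ A A A).symm (TensorProduct.assoc ℂ A A A
    (lact (leg12 (E * tmulMultiplier x 1)) _))
  rw [LinearEquiv.symm_apply_apply, leg12_mul, lact_mul, leg12_tmul_one, ← rTensor_lact_mk, hΦ]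

/-- With `y(v) = (ι ⊗ φ)Δ(v)`, this is `(ι ⊗ y)(w) = E((ι ⊗ φ)(w) ⊗ 1)` for `w ∈ E(A ⊗ A)`,
multiplied by `1 ⊗ c` from the right. -/
theorem RegularCoproduct.IsLeftIntegral.lTensor_lact {φ : A →ₗ[ℂ] ℂ} (hφ : D.IsLeftIntegral C φ)
    (hA : IsNondegenerateIdempotent A) (hD : D.IsFull)
    (hE : D.IsCanonicalIdempotent E) (hE' : D.IsWeaklyComultiplicative E)
    (hB : SitsNondegenerately B) (hC : SitsNondegenerately C)
    (hBC : IsRegularSeparabilityIdempotent B C E) (c : A) (w : A ⊗[ℂ] A) :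
    (sliceRight φ ∘ₗ D.T₄ ∘ₗ TensorProduct.mk ℂ A A c).lTensor A (lact E w) =
      lact E (sliceRight φ (lact E w) ⊗ₜ c) := by
  obtain ⟨Φ, hΦ⟩ := hBC.exists_flip_lTensor hA hD hE hB hC c
  have h1 (w : A ⊗[ℂ] A) : lact E (sliceRight φ (lact E w) ⊗ₜ c) =
      (sliceRight φ ∘ₗ Φ).lTensor A (lact E w) := by
    have := congrArg (sliceThird φ) (hΦ w)
    rw [sliceThird_rTensor, sliceThird_assoc_symm, ← LinearMap.lTensor_comp_apply] at this
    exact this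
  have h2 : sliceRight φ ∘ₗ D.T₄ ∘ₗ TensorProduct.mk ℂ A A c = sliceRight φ ∘ₗ Φ := by
    refine hD.eq_of_lTensor_T₄ hA fun d v => ?_
    rw [hφ.lTensor_T₄ hA hE hE' hC hBC]
    have := h1 (D.T₄ (d ⊗ₜ v))
    rwa [hE.lact_T₄ hA] at this
  rw [h2, h1]

end
end Coproducts

/-! ### The candidate for `R₁(p ⊗ c)` -/

section Coproducts

variable {A : Type*} [NonUnitalRing A] [Module ℂ A] [IsScalarTower ℂ A A] [SMulCommClass ℂ A A]
variable {D : RegularCoproduct A} {E : MultiplierAlgebra (A ⊗[ℂ] A)}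
  {B C : NonUnitalSubalgebra ℂ (MultiplierAlgebra A)}

theorem RegularCoproduct.delta13_tmul (a p q : A) :
    D.delta13 a (p ⊗ₜ q) = ((TensorProduct.mk ℂ A A).flip p).rTensor A (D.T₁ (a ⊗ₜ q)) := rfl

/-- `(T₁ ⊗ ι)(Δ₁₃(a)(1 ⊗ Δ(b)(c ⊗ 1))) = (ι ⊗ Δ)(Δ(a)(1 ⊗ b))(1 ⊗ c ⊗ 1)`. -/
theorem RegularCoproduct.T₁_delta13 (hA : IsNondegenerateIdempotent A) (a b c : A) :
    D.T₁.rTensor A (D.delta13 a (D.T₄ (c ⊗ₜ b))) = (TensorProduct.assoc ℂ A A A).symm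
      ((D.T₄ ∘ₗ TensorProduct.mk ℂ A A c).lTensor A (D.T₁ (a ⊗ₜ b))) := by
  apply (TensorProduct.assoc ℂ A A A).injective
  rw [LinearEquiv.apply_symm_apply]
  refine hA.rTensor_mulRight_separates fun u => ?_
  rw [rTensor_assoc, rTensor_lTensor_comm, D.rTensor_mulRight_T₁ hA, ← D.lTensor_mulRight_T₄ hA,
    ← LinearMap.lTensor_comp_apply]
  have h1 (t : A ⊗[ℂ] A) : TensorProduct.assoc ℂ A A A
      (((LinearMap.mulRight ℂ u).rTensor A).rTensor A (D.T₁.rTensor A (D.delta13 a t))) =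
        (D.deltaAct t).lTensor A (D.T₄ (u ⊗ₜ a)) := by
    refine LinearMap.congr_fun (f := (TensorProduct.assoc ℂ A A A).toLinearMap ∘ₗ
        ((LinearMap.mulRight ℂ u).rTensor A).rTensor A ∘ₗ D.T₁.rTensor A ∘ₗ D.delta13 a)
      (g := (LinearMap.lTensorHom A ∘ₗ D.deltaAct).flip (D.T₄ (u ⊗ₜ a)))
      (TensorProduct.ext' fun p q => ?_) t
    change TensorProduct.assoc ℂ A A A
      (((LinearMap.mulRight ℂ u).rTensor A).rTensor A (D.T₁.rTensor A (D.delta13 a (p ⊗ₜ q)))) =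
        (D.deltaAct (p ⊗ₜ q)).lTensor A (D.T₄ (u ⊗ₜ a))
    have h : (LinearMap.mulRight ℂ u).rTensor A ∘ₗ D.T₁ ∘ₗ (TensorProduct.mk ℂ A A).flip p =
        D.deltaAct (u ⊗ₜ p) := LinearMap.ext fun r => D.rTensor_mulRight_T₁ hA u r p
    rw [← coassoc_deltaAct hA, D.delta13_tmul, ← LinearMap.rTensor_comp_apply,
      ← LinearMap.rTensor_comp_apply, LinearMap.comp_assoc, h]
  have h2 : D.deltaAct (D.T₄ (c ⊗ₜ b)) =
      (D.T₄ ∘ₗ TensorProduct.mk ℂ A A c) ∘ₗ LinearMap.mulRight ℂ b :=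
    LinearMap.ext fun s => D.lact_delta_T₄ hA s c b
  rw [h1, h2]

/-- With `X = (ι ⊗ ι ⊗ φ)(Δ₁₃(a)(1 ⊗ Δ(b)(c ⊗ 1)))`, this is
`(d ⊗ 1)X = (ι ⊗ Q)((d ⊗ 1)Δ(a))`, where `Q(s) = (ι ⊗ φ)((1 ⊗ s)Δ(b))c`. -/
theorem RegularCoproduct.mulLeft_sliceThird_delta13 (hA : IsNondegenerateIdempotent A)
    (φ : A →ₗ[ℂ] ℂ) (a b c d : A) :
    (LinearMap.mulLeft ℂ d).rTensor A (sliceThird φ (D.delta13 a (D.T₄ (c ⊗ₜ b)))) =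
      (LinearMap.mulRight ℂ c ∘ₗ sliceRight φ ∘ₗ D.T₃ ∘ₗ TensorProduct.mk ℂ A A b).lTensor A
        (D.T₂ (d ⊗ₜ a)) := by
  -- `Ψ t s = (ι ⊗ φ)((1 ⊗ s)t)`
  let Ψ : A ⊗[ℂ] A →ₗ[ℂ] A →ₗ[ℂ] A :=
    LinearMap.flip ((LinearMap.llcomp ℂ (A ⊗[ℂ] A) (A ⊗[ℂ] A) A (sliceRight φ)) ∘ₗ
      LinearMap.lTensorHom A ∘ₗ LinearMap.mul ℂ A)
  have h1 (t : A ⊗[ℂ] A) : (LinearMap.mulLeft ℂ d).rTensor A (sliceThird φ (D.delta13 a t)) =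
      (Ψ t).lTensor A (D.T₂ (d ⊗ₜ a)) := by
    refine LinearMap.congr_fun
      (f := (LinearMap.mulLeft ℂ d).rTensor A ∘ₗ sliceThird φ ∘ₗ D.delta13 a)
      (g := (LinearMap.lTensorHom A ∘ₗ Ψ).flip (D.T₂ (d ⊗ₜ a)))
      (TensorProduct.ext' fun p q => ?_) t
    change (LinearMap.mulLeft ℂ d).rTensor A (sliceThird φ (D.delta13 a (p ⊗ₜ q))) =
      (Ψ (p ⊗ₜ q)).lTensor A (D.T₂ (d ⊗ₜ a))
    have h (w : A ⊗[ℂ] A) : (Ψ (p ⊗ₜ q)).lTensor A w =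
        sliceRight φ ((LinearMap.mulRight ℂ q).lTensor A w) ⊗ₜ p := by
      refine LinearMap.congr_fun (f := (Ψ (p ⊗ₜ q)).lTensor A)
        (g := (TensorProduct.mk ℂ A A).flip p ∘ₗ sliceRight φ ∘ₗ (LinearMap.mulRight ℂ q).lTensor A)
        (TensorProduct.ext' fun r s => ?_) w
      simp [Ψ, TensorProduct.smul_tmul']
    rw [h, D.lTensor_mulRight_T₂ hA, D.delta13_tmul, sliceThird_rTensor, LinearMap.flip_apply,
      TensorProduct.mk_apply, LinearMap.rTensor_tmul]
    congr 1
    exact LinearMap.congr_fun (f := LinearMap.mulLeft ℂ d ∘ₗ sliceRight φ)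
      (g := sliceRight φ ∘ₗ (LinearMap.mulLeft ℂ d).rTensor A)
      (TensorProduct.ext' fun r s => by simp) _
  rw [h1]
  congr 1
  refine congrArg _ (LinearMap.ext fun s => ?_)
  change sliceRight φ ((LinearMap.mulLeft ℂ s).lTensor A (D.T₄ (c ⊗ₜ b))) =
    sliceRight φ (D.T₃ (b ⊗ₜ s)) * c
  rw [D.lTensor_mulLeft_T₄ hA]
  exact LinearMap.congr_fun (f := sliceRight φ ∘ₗ (LinearMap.mulRight ℂ c).rTensor A)
      (g := LinearMap.mulRight ℂ c ∘ₗ sliceRight φ)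
      (TensorProduct.ext' fun r s => by simp) _

/-- `(d ⊗ 1)Δ((ι ⊗ φ)(Δ(a)(1 ⊗ b))) = (ι ⊗ P)((d ⊗ 1)Δ(a))`, where
`P(s) = (ι ⊗ φ)(Δ(s)(1 ⊗ b))`. -/
theorem RegularCoproduct.T₂_sliceRight_T₁ (φ : A →ₗ[ℂ] ℂ) (a b d : A) :
    D.T₂ (d ⊗ₜ sliceRight φ (D.T₁ (a ⊗ₜ b))) =
      (sliceRight φ ∘ₗ D.T₁ ∘ₗ (TensorProduct.mk ℂ A A).flip b).lTensor A (D.T₂ (d ⊗ₜ a)) := by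
  have h := congrArg (fun z => sliceThird φ ((TensorProduct.assoc ℂ A A A).symm z))
    (D.coassoc a b d)
  simp only [LinearEquiv.symm_apply_apply, sliceThird_rTensor, sliceThird_assoc_symm] at h
  rw [← LinearMap.lTensor_comp_apply] at h
  exact h

end Coproducts

end WMHA

theorem proposition2p15 {A : Type*} [NonUnitalRing A] [Module ℂ A] [IsScalarTower ℂ A A]
    [SMulCommClass ℂ A A] (hA : WMHA.IsNondegenerateIdempotent A)
    (D : WMHA.RegularCoproduct A) (hD : D.IsFull)
    (E : WMHA.MultiplierAlgebra (A ⊗[ℂ] A)) (hE : D.IsCanonicalIdempotent E)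
    (hE' : D.IsWeaklyComultiplicative E)
    (B C : NonUnitalSubalgebra ℂ (WMHA.MultiplierAlgebra A))
    (hB : WMHA.SitsNondegenerately B) (hC : WMHA.SitsNondegenerately C)
    (hBC : WMHA.IsRegularSeparabilityIdempotent B C E)
    (hleft : WMHA.IsFaithfulSet {φ | D.IsLeftIntegral C φ})
    (hright : WMHA.IsFaithfulSet {ψ | D.IsRightIntegral B ψ})
    (S : A →ₗ[ℂ] WMHA.MultiplierAlgebra A) (hS : D.IsAntipode E S)
    (φ : A →ₗ[ℂ] ℂ) (hφ : D.IsLeftIntegral C φ) (a b p : A)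
    (hp : p = WMHA.sliceRight φ (D.T₁ (a ⊗ₜ[ℂ] b))) :
    S p = WMHA.of A (WMHA.sliceRight φ (D.T₃ (b ⊗ₜ[ℂ] a))) := by
  obtain ⟨G₁, R₁, hG, hTR, hRT, hRTR, hSR⟩ := hS
  refine hA.lact_injective fun c => ?_
  have hR (a : A) : R₁ (WMHA.sliceRight φ (D.T₁ (a ⊗ₜ b)) ⊗ₜ c) =
      WMHA.sliceThird φ (D.delta13 a (D.T₄ (c ⊗ₜ b))) := by
    -- The element on the right is the `X` with `T₁(X) = E(p ⊗ c)` and `G₁(X) = X`.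
    have hT : D.T₁ (WMHA.sliceThird φ (D.delta13 a (D.T₄ (c ⊗ₜ b)))) =
        WMHA.lact E (WMHA.sliceRight φ (D.T₁ (a ⊗ₜ b)) ⊗ₜ c) := by
      have h := hφ.lTensor_lact hA hD hE hE' hB hC hBC c (D.T₁ (a ⊗ₜ b))
      rw [hE.lact_T₁ hA] at h
      rw [← WMHA.sliceThird_rTensor_tensor, D.T₁_delta13 hA, WMHA.sliceThird_assoc_symm,
        ← LinearMap.lTensor_comp_apply, h]
    have hGX : G₁ (WMHA.sliceThird φ (D.delta13 a (D.T₄ (c ⊗ₜ b)))) =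
        WMHA.sliceThird φ (D.delta13 a (D.T₄ (c ⊗ₜ b))) := by
      rw [← WMHA.sliceThird_rTensor_tensor, hG, hE.lact_T₄ hA]
    rw [← hRTR, hTR, ← hT, hRT, hGX]
  have key : (WMHA.actOn c ∘ₗ S) ∘ₗ
      (WMHA.sliceRight φ ∘ₗ D.T₁ ∘ₗ (TensorProduct.mk ℂ A A).flip b) =
      LinearMap.mulRight ℂ c ∘ₗ WMHA.sliceRight φ ∘ₗ D.T₃ ∘ₗ TensorProduct.mk ℂ A A b := by
    refine hD.eq_of_lTensor_T₂ fun d s => ?_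
    rw [← D.mulLeft_sliceThird_delta13 hA, LinearMap.lTensor_comp_apply, ← D.T₂_sliceRight_T₁,
      ← hSR, hR]
    rfl
  rw [hp]
  exact LinearMap.congr_fun key a
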